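/- Let $k$ be a non-archimedean local field with ring of integers $A$, uniformizer $\pi$ and residue field $\mathbb F=A/\pi A$ of odd characteristic. Let $V$ be a finite-dimensional $k$-vector space with a quadratic form $q:V\to k$ whose bilinear form $\langle v,w\rangle=q(v+w)-q(v)-q(w)$ is non-degenerate. For an orthogonal basis $e_1,\dots,e_n$ of $V$ put $a_i=q(e_i)$; let $d=a_1\cdots a_n\in k^*/k^{*2}$ be the determinant of $V$ and $\epsilon(V)=\prod_{i<j}(a_i,a_j)\in\{\pm1\}$ its Hasse-Witt invariant, where $(a,b)=+1$ if $z^2=ax^2+by^2$ has a non-trivial solution in $k$ and $(a,b)=-1$ otherwise. Assume that $d$ is the class of a unit of $A$. A lattice in $V$ is a finitely generated (hence free) $A$-submodule $L\subset V$ which spans $V$ over $k$ and on which $\langle\,,\rangle$ takes values in $A$; its dual is $L^\vee=\{v\in V:\langle v,w\rangle\in A\text{ for all }w\in L\}\supset L$, and $L$ is self-dual if $L^\vee=L$. Let $\mathrm{SO}(V)$ be the group of linear automorphisms of $V$ of determinant $1$ that preserve $q$. 1. If $\epsilon(V)=+1$, then $V$ contains a self-dual lattice, and any two self-dual lattices in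 $V$ are conjugate under $\mathrm{SO}(V)$. 2. If $\epsilon(V)=-1$, then $V$ contains no self-dual lattice. However, $V$ contains lattices $L$ such that $L^\vee/L$ is an $\mathbb F$-vector space which, with the quadratic form $x\mapsto \pi q(x)\bmod\pi$, is isometric to the quadratic field extension of $\mathbb F$ with its norm form; and any two such lattices are conjugate under $\mathrm{SO}(V)$. -/

import Mathlib

open ValuativeRel

noncomputable section

namespace OrthogonalLattice

section Invariants

variable {k : Type*} [Field k] {V : Type*} [AddCommGroup V] [Module k V]

open Classical in
/-- The Hilbert symbol `(a, b)` of a field `k` (used for nonzero `a`, `b`): it is `1` if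
`z ^ 2 = a * x ^ 2 + b * y ^ 2` has a nontrivial solution in `k`, and `-1` otherwise. -/
def hilbertSymbol (a b : k) : ℤˣ :=
  if ∃ x y z : k, (x ≠ 0 ∨ y ≠ 0 ∨ z ≠ 0) ∧ z ^ 2 = a * x ^ 2 + b * y ^ 2 then 1 else -1

/-- A basis of `V` whose members are pairwise orthogonal for
`⟨v, w⟩ = q (v + w) - q v - q w`. -/
def IsOrthogonalBasis {ι : Type*} (q : QuadraticForm k V) (e : Module.Basis ι k V) : Prop :=
  ∀ i j, i ≠ j → QuadraticMap.polar q (e i) (e j) = 0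

/-- The class in `k* / k*²` of `d` is the determinant of `(V, q)`: for an orthogonal basis `e`,
with `a i = q (e i)`, the product of the `a i` equals `d` up to a nonzero square. -/
def HasDeterminant (q : QuadraticForm k V) (d : k) : Prop :=
  ∃ e : Module.Basis (Fin (Module.finrank k V)) k V, IsOrthogonalBasis q e ∧
    ∃ c : k, c ≠ 0 ∧ ∏ i, q (e i) = d * c ^ 2

/-- The sign `s` is the Hasse-Witt invariant of `(V, q)`: for an orthogonal basis `e`, with
`a i = q (e i)`, it is the product of the Hilbert symbols `(a i, a j)` over `i < j`. For a
nondegenerate space over a local field of characteristic not `2`, orthogonal bases exist and the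
product does not depend on the choice of `e`. -/
def HasHasseWittInvariant (q : QuadraticForm k V) (s : ℤˣ) : Prop :=
  ∃ e : Module.Basis (Fin (Module.finrank k V)) k V, IsOrthogonalBasis q e ∧
    s = ∏ i, ∏ j ∈ Finset.Ioi i, hilbertSymbol (q (e i)) (q (e j))

/-- The special orthogonal group `SO(V)`: the linear automorphisms of `V` that preserve `q` and
have determinant `1`. -/
def specialOrthogonalGroup (q : QuadraticForm k V) : Subgroup (V ≃ₗ[k] V) where
  carrier := {g | (∀ v, q (g v) = q v) ∧ LinearEquiv.det g = 1}
  mul_mem' := by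
    rintro g h ⟨hg, hg'⟩ ⟨hh, hh'⟩
    refine ⟨fun v => ?_, by rw [map_mul, hg', hh', one_mul]⟩
    rw [LinearEquiv.mul_apply, hg, hh]
  one_mem' := ⟨fun _ => rfl, map_one _⟩
  inv_mem' := by
    rintro g ⟨hg, hg'⟩
    refine ⟨fun v => ?_, by rw [map_inv, hg', inv_one]⟩
    rw [← hg (g⁻¹ v)]
    exact congrArg q (LinearEquiv.apply_symm_apply g v)

end Invariants

section Lattices

variable {k : Type*} [Field k] [ValuativeRel k] {V : Type*} [AddCommGroup V] [Module k V]

/-- The dual `L^∨`: the vectors of `V` having integral pairing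
`⟨v, w⟩ = q (v + w) - q v - q w` with all `w` in `L`. -/
def dual (q : QuadraticForm k V) (L : Submodule 𝒪[k] V) : Submodule 𝒪[k] V :=
  LinearMap.BilinForm.dualSubmodule q.polarBilin L

/-- A lattice in `(V, q)`: a finitely generated (hence free, being torsion-free over a discrete
valuation ring) module over the ring of integers that spans `V` over `k`, and on which the bilinear
form is integral, i.e. `L ≤ L^∨`. -/
structure IsOrthogonalLattice (q : QuadraticForm k V) (L : Submodule 𝒪[k] V) : Prop where
  isLattice : Submodule.IsLattice k L
  le_dual : L ≤ dual q L

/-- A self-dual (non-degenerate) lattice. -/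
structure IsSelfDualLattice (q : QuadraticForm k V) (L : Submodule 𝒪[k] V) : Prop
    extends IsOrthogonalLattice q L where
  dual_eq : dual q L = L

/-- The quotient `L^∨ / L`. -/
abbrev DiscriminantModule (q : QuadraticForm k V) (L : Submodule 𝒪[k] V) : Type _ :=
  dual q L ⧸ L.submoduleOf (dual q L)

/-- A lattice `L` for which `L^∨ / L` is a vector space over the residue field `𝓀[k]` which,
equipped with the quadratic form `x ↦ ϖ * q x mod ϖ`, is isometric to `ℓ` with the norm form of
`ℓ / 𝓀[k]`. The isometry is `φ`; it transports the action of `𝒪[k]` on `L^∨ / L` to its action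
on `ℓ` through the residue field. -/
structure IsNormLattice (q : QuadraticForm k V) (ϖ : 𝒪[k]) (ℓ : Type*) [Field ℓ]
    [Algebra 𝓀[k] ℓ] (L : Submodule 𝒪[k] V) : Prop extends IsOrthogonalLattice q L where
  isometric : ∃ φ : DiscriminantModule q L ≃+ ℓ,
    (∀ (a : 𝒪[k]) (x : DiscriminantModule q L), φ (a • x) = IsLocalRing.residue 𝒪[k] a • φ x) ∧
    ∀ x : dual q L, ∃ b : 𝒪[k], (b : k) = (ϖ : k) * q (x : V) ∧
      IsLocalRing.residue 𝒪[k] b =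
        Algebra.norm 𝓀[k] (φ (Submodule.Quotient.mk x))

/-- Two lattices are conjugate under `SO(V)` if some element of `SO(V)` maps one onto the other. -/
def AreConjugate (q : QuadraticForm k V) (L L' : Submodule 𝒪[k] V) : Prop :=
  ∃ g ∈ specialOrthogonalGroup q,
    L.map ((g : V →ₗ[k] V).restrictScalars 𝒪[k]) = L'

end Lattices

end OrthogonalLattice

end

/-!
Write `O` for the ring of integers, `ϖ` for a uniformizer and `χ` for the quadratic character of
the units of `O`. By Hensel's lemma a unit is a square exactly when its residue class is one, and a
unimodular binary form represents every unit. Consequently unimodular diagonal forms, and their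
multiples by `ϖ`, are classified over `O` by rank and determinant (`IsDiagonal.change_units`).

*Uniqueness.* As `2` is a unit, every integral lattice has an orthogonal basis: a vector whose value
under `q` has least valuation splits off (`exists_isDiagonal`). For a self-dual lattice the values
on this basis are units. For a lattice whose discriminant form is the norm form, they are units and
`ϖ` times units; the discriminant form is anisotropic, and the number of values of the second kind
is even because the determinant of `V` is a unit, so that the lattice is `⟨us⟩ ⊥ ϖ ⟨1, -δ⟩` with a
non-square unit `δ` (`exists_isDiagonal_of_anisotropic`). The determinant of `V` then fixes the
classes of all the unimodular parts, two such lattices have orthogonal bases with the same values,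
and the isometry matching these bases has determinant `1` after a change of sign
(`exists_mem_specialOrthogonalGroup`).

*Existence.* Over `k`, an orthogonal basis can be scaled to have values `us` and `ϖ vs` with units
`us`, `vs`. The number `2 t` of the latter is even, and the formulas for the Hilbert symbol turn the
Hasse-Witt invariant into `χ ((-1) ^ t * ∏ vs)` (`exists_units_of_list`). By the classification of
unimodular forms, `ϖ ⟨vs⟩` is a sum of planes `ϖ ⟨1, -1⟩`, except that the last plane is `ϖ ⟨1, -δ⟩`
with `δ = (-1) ^ t * ∏ vs`. As `ϖ ⟨1, -1⟩` and `⟨1, -1⟩` are both hyperbolic planes over `k`, the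
space contains a self-dual lattice if `δ` is a square, and a lattice `⟨us⟩ ⊥ ϖ ⟨1, -δ⟩` otherwise
(`exists_isDiagonal_of_hasseWitt`); the discriminant form of the latter is the norm form
`x² - δ y²` (`IsDiagonal.exists_norm_isometry`).

*Exclusion.* A self-dual lattice and a lattice with anisotropic nonzero discriminant form cannot
lie in the same space (`dualSubmodule_ne_of_anisotropic`). In particular no independence of the
Hasse-Witt invariant from the orthogonal basis, and no Witt cancellation, is needed.
-/

namespace OrthogonalLattice

/-! ### Squares of units and the quadratic character -/

section Arithmetic

open IsLocalRing Polynomial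

variable {O : Type*} [CommRing O]

theorem isUnit_two_of_ringChar_residueField_ne_two [IsLocalRing O]
    (hk : ringChar (ResidueField O) ≠ 2) : IsUnit (2 : O) := by
  rw [← isUnit_map_iff (residue O), map_ofNat, isUnit_iff_ne_zero]
  exact Ring.two_ne_zero hk

variable [HenselianLocalRing O]

/-- Hensel's lemma for square roots: a nonzero square in the residue field lifts. -/
theorem exists_sq_eq_of_residue_eq_sq (hk : ringChar (ResidueField O) ≠ 2) {u : O}
    {r : ResidueField O} (hr : r ≠ 0) (h : residue O u = r ^ 2) : ∃ x : O, x ^ 2 = u := by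
  obtain ⟨x₀, rfl⟩ := residue_surjective r
  have h2 := isUnit_two_of_ringChar_residueField_ne_two hk
  have hx₀ : IsUnit x₀ := by rwa [← isUnit_map_iff (residue O), isUnit_iff_ne_zero]
  obtain ⟨x, hx, -⟩ := HenselianLocalRing.is_henselian (X ^ 2 - C u)
    (monic_X_pow_sub_C u two_ne_zero) x₀
    (by
      rw [← residue_eq_zero_iff]
      simp [h])
    (by simpa [derivative_X_pow, one_add_one_eq_two] using h2.mul hx₀)
  exact ⟨x, by simpa [IsRoot, sub_eq_zero] using hx⟩

variable [Finite (ResidueField O)]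

/-- Over a finite field of odd characteristic a nondegenerate binary quadratic form represents
every element; by Hensel's lemma a unimodular binary form represents every unit. -/
theorem exists_mul_sq_add_mul_sq_eq (hk : ringChar (ResidueField O) ≠ 2) (a b c : Oˣ) :
    ∃ x y : O, (a : O) * x ^ 2 + b * y ^ 2 = c := by
  have : Fintype (ResidueField O) := Fintype.ofFinite _
  have hne : ∀ u : Oˣ, residue O u ≠ 0 := fun u => (u.isUnit.map (residue O)).ne_zero
  obtain ⟨x, y, hxy⟩ := FiniteField.exists_root_sum_quadratic
    (f := C (residue O a) * X ^ 2) (g := C (residue O b) * X ^ 2 - C (residue O c))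
    (degree_C_mul_X_pow 2 (hne a))
    (by
      rw [degree_sub_C (by rw [degree_C_mul_X_pow 2 (hne b)]; norm_num)]
      exact degree_C_mul_X_pow 2 (hne b))
    (FiniteField.odd_card_of_char_ne_two hk)
  simp only [eval_mul, eval_C, eval_pow, eval_X, eval_sub] at hxy
  -- one of the two coordinates is a unit; the other may be lifted arbitrarily
  have key : ∀ (a b : Oˣ) (x y : ResidueField O), x ≠ 0 →
      residue O a * x ^ 2 + residue O b * y ^ 2 = residue O c →
      ∃ x y : O, (a : O) * x ^ 2 + b * y ^ 2 = c := by
    intro a b x y hx h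
    obtain ⟨y, rfl⟩ := residue_surjective y
    have hinv : residue O (↑a⁻¹ : O) * residue O a = 1 := by rw [← map_mul]; simp
    obtain ⟨x', hx'⟩ := exists_sq_eq_of_residue_eq_sq hk (u := ↑a⁻¹ * (c - b * y ^ 2)) hx (by
      simp only [map_mul, map_sub, map_pow]
      linear_combination -(residue O (↑a⁻¹ : O)) * h + x ^ 2 * hinv)
    refine ⟨x', y, ?_⟩
    rw [hx', Units.mul_inv_cancel_left]
    ring
  by_cases hx : x = 0
  · have hy : y ≠ 0 := by
      rintro rfl
      apply hne c
      rw [hx] at hxy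
      linear_combination -hxy
    obtain ⟨y', x', h⟩ := key b a y x hy (by linear_combination hxy)
    exact ⟨x', y', by rw [add_comm]; exact h⟩
  · exact key a b x y hx (by linear_combination hxy)

open Classical in
/-- The quadratic character of the units of `O`: the quadratic character of the finite residue
field, evaluated on the residue class. -/
noncomputable def unitsQuadraticChar (O : Type*) [CommRing O] [HenselianLocalRing O]
    [Finite (ResidueField O)] : Oˣ →* ℤˣ :=
  letI := Fintype.ofFinite (ResidueField O)
  (quadraticChar (ResidueField O)).toUnitHom.comp (Units.map (residue O : O →* ResidueField O))

theorem unitsQuadraticChar_eq_one_iff_isSquare_residue {u : Oˣ} :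
    unitsQuadraticChar O u = 1 ↔ IsSquare (residue O u) := by
  classical
  let := Fintype.ofFinite (ResidueField O)
  rw [← quadraticChar_one_iff_isSquare (u.isUnit.map (residue O)).ne_zero, Units.ext_iff]
  rfl

theorem unitsQuadraticChar_eq_one_iff (hk : ringChar (ResidueField O) ≠ 2) {u : Oˣ} :
    unitsQuadraticChar O u = 1 ↔ ∃ c : Oˣ, u = c ^ 2 := by
  rw [unitsQuadraticChar_eq_one_iff_isSquare_residue]
  constructor
  · rintro ⟨r, hr⟩
    have hu : residue O u ≠ 0 := (u.isUnit.map (residue O)).ne_zero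
    obtain ⟨x, hx⟩ := exists_sq_eq_of_residue_eq_sq hk (u := (u : O)) (r := r)
      (by rintro rfl; simp [hr] at hu) (by rw [hr, sq])
    have hxu : IsUnit x := by
      rw [← isUnit_pow_iff two_ne_zero, hx]
      exact u.isUnit
    exact ⟨hxu.unit, Units.ext (by simp [hx])⟩
  · rintro ⟨c, rfl⟩
    exact ⟨residue O c, by simp [sq]⟩

theorem unitsQuadraticChar_eq_neg_one_iff {u : Oˣ} :
    unitsQuadraticChar O u = -1 ↔ ¬ IsSquare (residue O u) := by
  rw [← unitsQuadraticChar_eq_one_iff_isSquare_residue]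
  rcases Int.units_eq_one_or (unitsQuadraticChar O u) with h | h <;> rw [h] <;> decide

theorem unitsQuadraticChar_sq (u : Oˣ) : unitsQuadraticChar O u ^ 2 = 1 := by
  rw [Int.units_sq]

/-- Two units with the same quadratic character differ by the square of a unit. -/
theorem exists_eq_mul_sq_of_unitsQuadraticChar_eq (hk : ringChar (ResidueField O) ≠ 2) {u v : Oˣ}
    (h : unitsQuadraticChar O u = unitsQuadraticChar O v) : ∃ c : Oˣ, u = v * c ^ 2 := by
  obtain ⟨c, hc⟩ := (unitsQuadraticChar_eq_one_iff hk (u := v⁻¹ * u)).1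
    (by rw [map_mul, map_inv, h, inv_mul_cancel])
  exact ⟨c, by rw [← hc, mul_inv_cancel_left]⟩

end Arithmetic

/-! ### Hilbert symbols -/

section HilbertSymbol

variable {k : Type*} [Field k]

theorem hilbertSymbol_comm (a b : k) : hilbertSymbol a b = hilbertSymbol b a := by
  unfold hilbertSymbol
  congr 1
  refine propext ⟨?_, ?_⟩ <;> rintro ⟨x, y, z, h, e⟩ <;>
    exact ⟨y, x, z, by tauto, by rw [e, add_comm]⟩

theorem hilbertSymbol_eq_one_iff {a b : k} : hilbertSymbol a b = 1 ↔
    ∃ x y z : k, (x ≠ 0 ∨ y ≠ 0 ∨ z ≠ 0) ∧ z ^ 2 = a * x ^ 2 + b * y ^ 2 := by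
  unfold hilbertSymbol
  split_ifs with h
  · simpa using h
  · refine iff_of_false (by decide) h

theorem hilbertSymbol_eq_of_iff {a b : k} {s : ℤˣ} (h : hilbertSymbol a b = 1 ↔ s = 1) :
    hilbertSymbol a b = s := by
  rcases Int.units_eq_one_or (hilbertSymbol a b) with h1 | h1 <;>
  rcases Int.units_eq_one_or s with h2 | h2 <;> simp_all

theorem hilbertSymbol_mul_sq_left (a b : k) {c : k} (hc : c ≠ 0) :
    hilbertSymbol (a * c ^ 2) b = hilbertSymbol a b := by
  apply hilbertSymbol_eq_of_iff
  rw [hilbertSymbol_eq_one_iff, hilbertSymbol_eq_one_iff]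
  constructor
  · rintro ⟨x, y, z, h, e⟩
    exact ⟨c * x, y, z, by simpa [hc] using h, by rw [e]; ring⟩
  · rintro ⟨x, y, z, h, e⟩
    exact ⟨c⁻¹ * x, y, z, by simpa [hc] using h, by rw [e]; field_simp⟩

theorem hilbertSymbol_mul_sq_right (a b : k) {c : k} (hc : c ≠ 0) :
    hilbertSymbol a (b * c ^ 2) = hilbertSymbol a b := by
  rw [hilbertSymbol_comm, hilbertSymbol_mul_sq_left _ _ hc, hilbertSymbol_comm]

open IsLocalRing

theorem hilbertSymbol_unit_unit {O : Type*} [CommRing O] [HenselianLocalRing O]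
    [Finite (ResidueField O)] [Algebra O k] (hk : ringChar (ResidueField O) ≠ 2) (u v : Oˣ) :
    hilbertSymbol (algebraMap O k u) (algebraMap O k v) = 1 := by
  obtain ⟨x, y, h⟩ := exists_mul_sq_add_mul_sq_eq hk u v 1
  refine hilbertSymbol_eq_one_iff.2 ⟨algebraMap O k x, algebraMap O k y, 1, by simp, ?_⟩
  simp only [← map_pow, ← map_mul, ← map_add, h]
  simp

variable {O : Type*} [CommRing O] [IsDomain O] [IsDiscreteValuationRing O] [Algebra O k]
  [IsFractionRing O k]

/-- A finite family of elements of `k`, not all zero, can be scaled to a primitive one. Stated for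
triples, and with a homogeneous quadratic equation in mind. -/
theorem exists_primitive_triple {ϖ : O} (hϖ : Irreducible ϖ) {x y z : k}
    (h : x ≠ 0 ∨ y ≠ 0 ∨ z ≠ 0) : ∃ (c : k) (x' y' z' : O), c ≠ 0 ∧
      algebraMap O k x' = c * x ∧ algebraMap O k y' = c * y ∧ algebraMap O k z' = c * z ∧
      ¬ (ϖ ∣ x' ∧ ϖ ∣ y' ∧ ϖ ∣ z') := by
  classical
  obtain ⟨d, hd⟩ := IsLocalization.exist_integer_multiples_of_finset (nonZeroDivisors O)
    ({x, y, z} : Finset k)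
  obtain ⟨x₀, hx₀⟩ := hd x (by simp)
  obtain ⟨y₀, hy₀⟩ := hd y (by simp)
  obtain ⟨z₀, hz₀⟩ := hd z (by simp)
  have hd0 : algebraMap O k d ≠ 0 := by simp
  have hinj : Function.Injective (algebraMap O k) := IsFractionRing.injective O k
  rw [Algebra.smul_def] at hx₀ hy₀ hz₀
  -- divide by the highest power of `ϖ` that divides all three numerators
  have hfin : ∃ n : ℕ, ¬ (ϖ ^ n ∣ x₀ ∧ ϖ ^ n ∣ y₀ ∧ ϖ ^ n ∣ z₀) := by
    have key : ∀ w : O, w ≠ 0 → ∃ n : ℕ, ¬ ϖ ^ n ∣ w := fun w hw => by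
      obtain ⟨n, hn⟩ := FiniteMultiplicity.of_prime_left hϖ.prime hw
      exact ⟨n + 1, hn⟩
    have hne : ∀ (w : O) (v : k), algebraMap O k w = algebraMap O k d * v → v ≠ 0 → w ≠ 0 := by
      rintro w v e hv rfl
      rw [map_zero] at e
      exact mul_ne_zero hd0 hv e.symm
    rcases h with h | h | h
    · obtain ⟨n, hn⟩ := key x₀ (hne _ _ hx₀ h); exact ⟨n, fun h => hn h.1⟩
    · obtain ⟨n, hn⟩ := key y₀ (hne _ _ hy₀ h); exact ⟨n, fun h => hn h.2.1⟩
    · obtain ⟨n, hn⟩ := key z₀ (hne _ _ hz₀ h); exact ⟨n, fun h => hn h.2.2⟩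
  obtain ⟨n, hn⟩ : ∃ n, Nat.find hfin = n + 1 := Nat.exists_eq_succ_of_ne_zero (by
    intro h0
    have := Nat.find_spec hfin
    rw [h0] at this
    simp at this)
  have hmin := not_not.1 (Nat.find_min hfin (m := n) (by omega))
  have hspec := Nat.find_spec hfin
  rw [hn] at hspec
  obtain ⟨⟨x₁, rfl⟩, ⟨y₁, rfl⟩, ⟨z₁, rfl⟩⟩ := hmin
  have hp : algebraMap O k (ϖ ^ n) ≠ 0 := by
    rw [map_ne_zero_iff _ hinj]
    exact pow_ne_zero _ hϖ.ne_zero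
  refine ⟨algebraMap O k d / algebraMap O k (ϖ ^ n), x₁, y₁, z₁, div_ne_zero hd0 hp, ?_, ?_, ?_, ?_⟩
  · rw [div_mul_eq_mul_div, eq_div_iff hp, ← hx₀, map_mul, mul_comm]
  · rw [div_mul_eq_mul_div, eq_div_iff hp, ← hy₀, map_mul, mul_comm]
  · rw [div_mul_eq_mul_div, eq_div_iff hp, ← hz₀, map_mul, mul_comm]
  · rintro ⟨h1, h2, h3⟩
    exact hspec ⟨by rw [pow_succ]; exact mul_dvd_mul_left _ h1,
      by rw [pow_succ]; exact mul_dvd_mul_left _ h2, by rw [pow_succ]; exact mul_dvd_mul_left _ h3⟩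

/-- If the Hilbert symbol of two elements of `O` is `1`, the defining equation has a primitive
solution in `O`. -/
theorem exists_primitive_of_hilbertSymbol_eq_one {ϖ : O} (hϖ : Irreducible ϖ) {a b : O}
    (h : hilbertSymbol (algebraMap O k a) (algebraMap O k b) = 1) :
    ∃ x y z : O, z ^ 2 = a * x ^ 2 + b * y ^ 2 ∧ ¬ (ϖ ∣ x ∧ ϖ ∣ y ∧ ϖ ∣ z) := by
  obtain ⟨x, y, z, h0, e⟩ := hilbertSymbol_eq_one_iff.1 h
  obtain ⟨c, x', y', z', hc, hx, hy, hz, hp⟩ := exists_primitive_triple hϖ h0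
  refine ⟨x', y', z', IsFractionRing.injective O k ?_, hp⟩
  simp only [map_add, map_mul, map_pow, hx, hy, hz]
  linear_combination c ^ 2 * e

/-- Up to squares, a nonzero element of `k` is a unit or a uniformizer times a unit. -/
theorem exists_eq_unit_mul_sq_or {ϖ : O} (hϖ : Irreducible ϖ) {a : k} (ha : a ≠ 0) :
    ∃ (u : Oˣ) (c : k), c ≠ 0 ∧
      (a = algebraMap O k u * c ^ 2 ∨ a = algebraMap O k (ϖ * u) * c ^ 2) := by
  obtain ⟨n, u, rfl⟩ := IsDiscreteValuationRing.exists_units_eq_smul_zpow_of_irreducible hϖ ha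
  have hϖ0 : algebraMap O k ϖ ≠ 0 := by
    rw [map_ne_zero_iff _ (IsFractionRing.injective O k)]
    exact hϖ.ne_zero
  rcases Int.even_or_odd' n with ⟨m, rfl | rfl⟩
  · refine ⟨u, algebraMap O k ϖ ^ m, zpow_ne_zero _ hϖ0, Or.inl ?_⟩
    rw [Units.smul_def, Algebra.smul_def, mul_comm 2 m, zpow_mul, zpow_ofNat]
  · refine ⟨u, algebraMap O k ϖ ^ m, zpow_ne_zero _ hϖ0, Or.inr ?_⟩
    rw [Units.smul_def, Algebra.smul_def, zpow_add_one₀ hϖ0, mul_comm 2 m, zpow_mul, map_mul,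
      zpow_ofNat]
    ring

theorem exists_unit_eq_mul_sq {u v : Oˣ} {c : k}
    (h : algebraMap O k u = algebraMap O k v * c ^ 2) : ∃ w : Oˣ, u = v * w ^ 2 := by
  have hv : algebraMap O k (↑v⁻¹ : O) * algebraMap O k v = 1 := by rw [← map_mul]; simp
  have hc : c ^ 2 = algebraMap O k (↑(v⁻¹ * u) : O) := by
    rw [Units.val_mul, map_mul, h, ← mul_assoc, hv, one_mul]
  obtain ⟨w, rfl⟩ := IsIntegrallyClosed.exists_algebraMap_eq_of_isIntegral_pow (R := O) two_pos
    (hc ▸ isIntegral_algebraMap)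
  rw [← map_pow] at hc
  have hw := IsFractionRing.injective O k hc
  have hwu : IsUnit w := by
    rw [← isUnit_pow_iff two_ne_zero, hw]
    exact Units.isUnit _
  refine ⟨hwu.unit, ?_⟩
  have : hwu.unit ^ 2 = v⁻¹ * u := Units.ext (by simpa using hw)
  rw [this, mul_inv_cancel_left]

theorem even_of_unit_mul_pow_mul_sq_eq {ϖ : O} (hϖ : Irreducible ϖ) {u v : Oˣ} {c d : k}
    (hc : c ≠ 0) {m : ℕ}
    (h : algebraMap O k u * algebraMap O k ϖ ^ m * c ^ 2 = algebraMap O k v * d ^ 2) : Even m := by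
  by_contra hm
  obtain ⟨j, rfl⟩ := Nat.not_even_iff_odd.1 hm
  have hϖ0 : algebraMap O k ϖ ≠ 0 := by
    rw [map_ne_zero_iff _ (IsFractionRing.injective O k)]
    exact hϖ.ne_zero
  have hv : algebraMap O k (↑v⁻¹ : O) * algebraMap O k v = 1 := by rw [← map_mul]; simp
  -- a square root of `ϖ` times a unit would lie in `O`, against irreducibility
  have he : (d / (algebraMap O k ϖ ^ j * c)) ^ 2 = algebraMap O k (↑v⁻¹ * u * ϖ) := by
    simp only [map_mul]
    field_simp
    linear_combination -algebraMap O k (↑v⁻¹ : O) * h - d ^ 2 * hv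
  obtain ⟨e, h1⟩ := IsIntegrallyClosed.exists_algebraMap_eq_of_isIntegral_pow (R := O) two_pos
    (he ▸ isIntegral_algebraMap)
  rw [← h1, ← map_pow] at he
  have he' := IsFractionRing.injective O k he
  have h2 : ϖ = (↑(u⁻¹ * v) : O) * (e * e) := by
    rw [← pow_two, he', ← mul_assoc, ← mul_assoc, ← Units.val_mul, ← Units.val_mul]
    simp
  have hirr : Irreducible (e * e) := by
    rw [h2] at hϖ
    exact (irreducible_units_mul _).1 hϖ
  rcases hirr.isUnit_or_isUnit rfl with hu | hu <;> exact hirr.not_isUnit (hu.mul hu)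

variable [HenselianLocalRing O] [Finite (ResidueField O)]

theorem hilbertSymbol_uniformizer_mul_unit_unit (hk : ringChar (ResidueField O) ≠ 2) {ϖ : O}
    (hϖ : Irreducible ϖ) (u v : Oˣ) :
    hilbertSymbol (algebraMap O k (ϖ * u)) (algebraMap O k v) = unitsQuadraticChar O v := by
  apply hilbertSymbol_eq_of_iff
  constructor
  · intro h
    obtain ⟨x, y, z, e, hp⟩ := exists_primitive_of_hilbertSymbol_eq_one hϖ h
    have hr : ∀ w : O, residue O w = 0 ↔ ϖ ∣ w := fun w => by
      rw [residue_eq_zero_iff, hϖ.maximalIdeal_eq, Ideal.mem_span_singleton]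
    have hr' : residue O z ^ 2 = residue O v * residue O y ^ 2 := by
      have := congrArg (residue O) e
      simpa [(hr ϖ).2 dvd_rfl] using this
    by_cases hy : residue O y = 0
    · exfalso
      have hz : residue O z = 0 := by simpa [hy] using hr'
      refine hp ⟨?_, (hr y).1 hy, (hr z).1 hz⟩
      obtain ⟨y, rfl⟩ := (hr y).1 hy
      obtain ⟨z, rfl⟩ := (hr z).1 hz
      have : (u : O) * x ^ 2 = ϖ * (z ^ 2 - v * y ^ 2) :=
        mul_left_cancel₀ hϖ.ne_zero (by linear_combination -e)
      exact hϖ.prime.dvd_of_dvd_pow ((u.isUnit.dvd_mul_left).1 ⟨_, this⟩)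
    · rw [unitsQuadraticChar_eq_one_iff_isSquare_residue]
      exact ⟨residue O z / residue O y, by field_simp; exact hr'.symm⟩
  · intro h
    obtain ⟨c, rfl⟩ := (unitsQuadraticChar_eq_one_iff hk).1 h
    exact hilbertSymbol_eq_one_iff.2 ⟨0, 1, algebraMap O k c, by simp, by simp⟩

theorem hilbertSymbol_uniformizer_mul_unit_uniformizer_mul_unit
    (hk : ringChar (ResidueField O) ≠ 2) {ϖ : O} (hϖ : Irreducible ϖ) (u v : Oˣ) :
    hilbertSymbol (algebraMap O k (ϖ * u)) (algebraMap O k (ϖ * v)) =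
      unitsQuadraticChar O (-(u * v)) := by
  apply hilbertSymbol_eq_of_iff
  constructor
  · intro h
    obtain ⟨x, y, z, e, hp⟩ := exists_primitive_of_hilbertSymbol_eq_one hϖ h
    have hr : ∀ w : O, residue O w = 0 ↔ ϖ ∣ w := fun w => by
      rw [residue_eq_zero_iff, hϖ.maximalIdeal_eq, Ideal.mem_span_singleton]
    have hz : ϖ ∣ z := hϖ.prime.dvd_of_dvd_pow (n := 2)
      ⟨u * x ^ 2 + v * y ^ 2, by linear_combination e⟩
    obtain ⟨z, rfl⟩ := hz
    have e' : ϖ * z ^ 2 = u * x ^ 2 + v * y ^ 2 :=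
      mul_left_cancel₀ hϖ.ne_zero (by linear_combination e)
    have hr' : residue O u * residue O x ^ 2 + residue O v * residue O y ^ 2 = 0 := by
      have := congrArg (residue O) e'
      simpa [(hr ϖ).2 dvd_rfl] using this.symm
    have hu : residue O u ≠ 0 := (u.isUnit.map (residue O)).ne_zero
    by_cases hy : residue O y = 0
    · have hx : residue O x = 0 := by simpa [hy, hu] using hr'
      exact (hp ⟨(hr x).1 hx, (hr y).1 hy, dvd_mul_right _ _⟩).elim
    · rw [unitsQuadraticChar_eq_one_iff_isSquare_residue]
      refine ⟨residue O u * residue O x / residue O y, ?_⟩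
      simp only [Units.val_neg, Units.val_mul, map_neg, map_mul]
      field_simp
      linear_combination -hr'
  · intro h
    obtain ⟨c, hc⟩ := (unitsQuadraticChar_eq_one_iff hk).1 h
    refine hilbertSymbol_eq_one_iff.2 ⟨algebraMap O k c, algebraMap O k u, 0, by simp, ?_⟩
    have hc' := congrArg Units.val hc
    simp only [Units.val_neg, Units.val_mul, Units.val_pow_eq_pow_val] at hc'
    simp only [← map_pow, ← map_mul, ← map_add, ← hc']
    rw [zero_pow two_ne_zero, ← map_zero (algebraMap O k)]
    congr 1
    ring

end HilbertSymbol

/-! ### Orthogonal diagonalizations -/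

section Diagonal

open QuadraticMap

variable {k : Type*} [Field k] {V : Type*} [AddCommGroup V] [Module k V]
  {R : Type*} [CommRing R] [Module R V] {q : QuadraticForm k V}

/-- `IsDiagonal q l L` says that the `R`-submodule `L` of `V` is the orthogonal sum of submodules
`R x` on whose generators `x` the form `q` takes the values listed in `l`. The generators are not
required to be independent, but they are as soon as the values in `l` are nonzero. -/
def IsDiagonal (q : QuadraticForm k V) : List k → Submodule R V → Prop
  | [], L => L = ⊥
  | a :: l, L => ∃ (x : V) (M : Submodule R V), q x = a ∧ (∀ y ∈ M, polar q x y = 0) ∧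
      IsDiagonal q l M ∧ L = R ∙ x ⊔ M

theorem polar_eq_zero_of_mem_sup {L M : Submodule R V} {y z : V} (hL : ∀ x ∈ L, polar q y x = 0)
    (hM : ∀ x ∈ M, polar q y x = 0) (hz : z ∈ L ⊔ M) : polar q y z = 0 := by
  obtain ⟨a, ha, b, hb, rfl⟩ := Submodule.mem_sup.1 hz
  rw [polar_add_right, hL a ha, hM b hb, add_zero]

theorem IsDiagonal.exists_family {l : List k} {L : Submodule R V} (h : IsDiagonal q l L) :
    ∃ e : Fin l.length → V, (∀ i j, i ≠ j → polar q (e i) (e j) = 0) ∧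
      (∀ i, q (e i) = l.get i) ∧ Submodule.span R (Set.range e) = L := by
  induction l generalizing L with
  | nil =>
    have : IsEmpty (Fin ([] : List k).length) := Fin.isEmpty
    refine ⟨isEmptyElim, isEmptyElim, isEmptyElim, ?_⟩
    rw [Set.range_eq_empty, Submodule.span_empty]
    exact h.symm
  | cons a l ih =>
    obtain ⟨x, M, hx, hM, h, rfl⟩ := h
    obtain ⟨e, he, hq, rfl⟩ := ih h
    have hM' : ∀ i, polar q x (e i) = 0 := fun i => hM _ (Submodule.subset_span ⟨i, rfl⟩)
    refine ⟨Fin.cons x e, fun i j => ?_, fun i => ?_, ?_⟩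
    · refine Fin.cases (Fin.cases ?_ (fun j _ => ?_) j)
        (fun i => Fin.cases (fun _ => ?_) (fun j hij => ?_) j) i
      · exact fun h => (h rfl).elim
      · simpa using hM' j
      · simpa [polar_comm] using hM' i
      · simpa using he i j (fun h => hij (h ▸ rfl))
    · refine Fin.cases ?_ (fun i => ?_) i
      · simpa using hx
      · simpa using hq i
    · rw [Fin.range_cons, Submodule.span_insert]

theorem IsDiagonal.fg {l : List k} {L : Submodule R V} (h : IsDiagonal q l L) : L.FG := by
  obtain ⟨e, -, -, rfl⟩ := h.exists_family
  exact Submodule.fg_span (Set.finite_range e)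

variable [Algebra R k] [IsScalarTower R k V]

theorem polar_eq_zero_of_mem_span_singleton {x y z : V} (h : polar q x y = 0) (hz : z ∈ R ∙ x) :
    polar q z y = 0 := by
  obtain ⟨c, rfl⟩ := Submodule.mem_span_singleton.1 hz
  rw [polar_smul_left_of_tower, h, smul_zero]

theorem polar_eq_zero_of_mem_span {s : Set V} {y z : V} (h : ∀ x ∈ s, polar q y x = 0)
    (hz : z ∈ Submodule.span R s) : polar q y z = 0 := by
  induction hz using Submodule.span_induction with
  | mem x hx => exact h x hx
  | zero => exact polar_zero_right q y
  | add a b _ _ ha hb => rw [polar_add_right, ha, hb, add_zero]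
  | smul c a _ ha => rw [polar_smul_right_of_tower, ha, smul_zero]

theorem isDiagonal_append {l₁ l₂ : List k} {L : Submodule R V} :
    IsDiagonal q (l₁ ++ l₂) L ↔ ∃ L₁ L₂ : Submodule R V, IsDiagonal q l₁ L₁ ∧ IsDiagonal q l₂ L₂ ∧
      (∀ x ∈ L₁, ∀ y ∈ L₂, polar q x y = 0) ∧ L = L₁ ⊔ L₂ := by
  induction l₁ generalizing L with
  | nil =>
    constructor
    · intro h
      exact ⟨⊥, L, rfl, h, by simp +contextual [polar_zero_left], by simp⟩
    · rintro ⟨_, L₂, rfl, h, -, rfl⟩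
      simpa using h
  | cons a l ih =>
    constructor
    · rintro ⟨x, M, hx, hM, h, rfl⟩
      obtain ⟨L₁, L₂, h₁, h₂, h₁₂, rfl⟩ := ih.1 h
      refine ⟨R ∙ x ⊔ L₁, L₂, ⟨x, L₁, hx, fun y hy => hM y (Submodule.mem_sup_left hy), h₁, rfl⟩,
        h₂, fun y hy z hz => ?_, (sup_assoc ..).symm⟩
      rw [polar_comm]
      refine polar_eq_zero_of_mem_sup (fun w hw => ?_) (fun w hw => ?_) hy
      · rw [polar_comm]
        exact polar_eq_zero_of_mem_span_singleton (hM z (Submodule.mem_sup_right hz)) hw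
      · rw [polar_comm]
        exact h₁₂ w hw z hz
    · rintro ⟨_, L₂, ⟨x, M, hx, hM, h, rfl⟩, h₂, h₁₂, rfl⟩
      refine ⟨x, M ⊔ L₂, hx, fun y hy => polar_eq_zero_of_mem_sup hM (fun z hz => ?_) hy,
        ih.2 ⟨M, L₂, h, h₂, fun y hy z hz => h₁₂ y (Submodule.mem_sup_right hy) z hz, rfl⟩,
        sup_assoc ..⟩
      exact h₁₂ x (Submodule.mem_sup_left (Submodule.mem_span_singleton_self x)) z hz

theorem IsDiagonal.perm {l₁ l₂ : List k} (hl : l₁.Perm l₂) {L : Submodule R V}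
    (h : IsDiagonal q l₁ L) : IsDiagonal q l₂ L := by
  induction hl generalizing L with
  | nil => exact h
  | cons a _ ih =>
    obtain ⟨x, M, hx, hM, h, rfl⟩ := h
    exact ⟨x, M, hx, hM, ih h, rfl⟩
  | swap a b l =>
    obtain ⟨x, _, hx, hM, ⟨y, M, hy, hM', h, rfl⟩, rfl⟩ := h
    refine ⟨y, R ∙ x ⊔ M, hy, fun z hz => polar_eq_zero_of_mem_sup (fun w hw => ?_) hM' hz,
      ⟨x, M, hx, fun z hz => hM z (Submodule.mem_sup_right hz), h, rfl⟩, sup_left_comm ..⟩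
    rw [polar_comm]
    refine polar_eq_zero_of_mem_span_singleton (hM y ?_) hw
    exact Submodule.mem_sup_left (Submodule.mem_span_singleton_self y)
  | trans _ _ ih₁ ih₂ => exact ih₂ (ih₁ h)

theorem isDiagonal_ofFn {n : ℕ} (e : Fin n → V) (he : ∀ i j, i ≠ j → polar q (e i) (e j) = 0) :
    IsDiagonal q (List.ofFn fun i => q (e i)) (Submodule.span R (Set.range e)) := by
  induction n with
  | zero =>
    rw [Set.range_eq_empty, Submodule.span_empty]
    exact rfl
  | succ n ih =>
    rw [List.ofFn_succ]
    refine ⟨e 0, Submodule.span R (Set.range fun i => e (Fin.succ i)), rfl, fun y hy => ?_,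
      ih (fun i => e i.succ) (fun i j hij => he _ _ (by simpa using hij)), ?_⟩
    · refine polar_eq_zero_of_mem_span ?_ hy
      rintro _ ⟨i, rfl⟩
      exact he _ _ (Fin.succ_ne_zero i).symm
    · rw [← Submodule.span_insert, ← Fin.range_cons]
      congr 2
      exact (Fin.cons_self_tail e).symm

theorem IsDiagonal.span {l : List k} {L : Submodule R V} (h : IsDiagonal q l L) :
    IsDiagonal q l (Submodule.span k (L : Set V)) := by
  obtain ⟨e, he, hq, rfl⟩ := h.exists_family
  have := isDiagonal_ofFn (R := k) e he
  simp only [hq, List.ofFn_get] at this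
  rwa [Submodule.span_span_of_tower]

theorem IsDiagonal.exists_span_eq (R : Type*) [CommRing R] [Algebra R k] [Module R V]
    [IsScalarTower R k V] {l : List k} {W : Submodule k V} (h : IsDiagonal q l W) :
    ∃ L : Submodule R V, IsDiagonal q l L ∧ Submodule.span k (L : Set V) = W := by
  obtain ⟨e, he, hq, rfl⟩ := h.exists_family
  have := isDiagonal_ofFn (R := R) e he
  simp only [hq, List.ofFn_get] at this
  exact ⟨_, this, Submodule.span_span_of_tower ..⟩

theorem polar_self_eq (x : V) : polar q x x = 2 * q x := by
  rw [polar_self, nsmul_eq_mul]; norm_num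

theorem linearIndependent_of_polar_eq_zero (h2 : (2 : k) ≠ 0) {ι : Type*} {e : ι → V}
    (he : ∀ i j, i ≠ j → polar q (e i) (e j) = 0) (hq : ∀ i, q (e i) ≠ 0) :
    LinearIndependent k e :=
  LinearMap.linearIndependent_of_isOrthoᵢ (B := q.polarBilin) (fun i j hij => he i j hij)
    fun i => by
      rw [polarBilin_apply_apply, polar_self_eq]
      exact mul_ne_zero h2 (hq i)

/-- A diagonalization with nonzero values of a submodule spanning `V` comes from an orthogonal
basis of `V`. -/
theorem IsDiagonal.exists_basis (h2 : (2 : k) ≠ 0) {l : List k} (hl : ∀ a ∈ l, a ≠ 0)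
    {L : Submodule R V} (h : IsDiagonal q l L) (hL : Submodule.span k (L : Set V) = ⊤) :
    ∃ e : Module.Basis (Fin l.length) k V, IsOrthogonalBasis q e ∧ (∀ i, q (e i) = l.get i) ∧
      Submodule.span R (Set.range e) = L := by
  obtain ⟨e, he, hq, rfl⟩ := h.exists_family
  rw [Submodule.span_span_of_tower] at hL
  let b := Module.Basis.mk (linearIndependent_of_polar_eq_zero h2 he
    fun i => by rw [hq]; exact hl _ (List.get_mem ..)) hL.ge
  have hb : ⇑b = e := Module.Basis.coe_mk ..
  exact ⟨b, by rw [IsOrthogonalBasis, hb]; exact he, by rw [hb]; exact hq, by rw [hb]⟩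

/-- The determinant of a quadratic space is well defined modulo squares. -/
theorem prod_eq_prod_mul_sq_of_basis (h2 : (2 : k) ≠ 0) {n : ℕ} {e e' : Module.Basis (Fin n) k V}
    (he : IsOrthogonalBasis q e) (he' : IsOrthogonalBasis q e') :
    ∏ i, q (e i) = (∏ i, q (e' i)) * (e'.det e) ^ 2 := by
  have key : ∀ f : Module.Basis (Fin n) k V, IsOrthogonalBasis q f →
      (LinearMap.BilinForm.toMatrix f q.polarBilin).det = 2 ^ n * ∏ i, q (f i) := by
    intro f hf
    have : LinearMap.BilinForm.toMatrix f q.polarBilin = Matrix.diagonal fun i => 2 * q (f i) := by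
      ext i j
      rw [LinearMap.BilinForm.toMatrix_apply, polarBilin_apply_apply]
      by_cases hij : i = j
      · subst hij
        rw [Matrix.diagonal_apply_eq, polar_self_eq]
      · rw [Matrix.diagonal_apply_ne _ hij, hf i j hij]
    rw [this, Matrix.det_diagonal, Finset.prod_mul_distrib]
    simp
  have h := congrArg Matrix.det (LinearMap.BilinForm.toMatrix_mul_basis_toMatrix e' e q.polarBilin)
  rw [Matrix.det_mul, Matrix.det_mul, Matrix.det_transpose, key e he, key e' he',
    ← Module.Basis.det_apply] at h
  apply mul_left_cancel₀ (pow_ne_zero n h2)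
  linear_combination -h

theorem IsDiagonal.length_eq (h2 : (2 : k) ≠ 0) {l : List k} (hl : ∀ a ∈ l, a ≠ 0)
    {L : Submodule R V} (h : IsDiagonal q l L) (hL : Submodule.span k (L : Set V) = ⊤) :
    l.length = Module.finrank k V := by
  obtain ⟨e, -⟩ := h.exists_basis h2 hl hL
  rw [Module.finrank_eq_card_basis e, Fintype.card_fin]

theorem IsDiagonal.exists_prod_eq_prod_mul_sq (h2 : (2 : k) ≠ 0) {l l' : List k}
    (hl : ∀ a ∈ l, a ≠ 0) (hl' : ∀ a ∈ l', a ≠ 0) {L L' : Submodule R V} (h : IsDiagonal q l L)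
    (h' : IsDiagonal q l' L') (hL : Submodule.span k (L : Set V) = ⊤)
    (hL' : Submodule.span k (L' : Set V) = ⊤) : ∃ c : k, c ≠ 0 ∧ l.prod = l'.prod * c ^ 2 := by
  obtain ⟨e, he, hq, -⟩ := h.exists_basis h2 hl hL
  obtain ⟨e', he', hq', -⟩ := h'.exists_basis h2 hl' hL'
  have hlen : l'.length = l.length := by
    rw [h.length_eq h2 hl hL, h'.length_eq h2 hl' hL']
  let f := e'.reindex (finCongr hlen)
  have hf : IsOrthogonalBasis q f := by
    intro i j hij
    simp only [f, Module.Basis.reindex_apply]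
    exact he' _ _ (by simpa using hij)
  refine ⟨f.det e, (f.isUnit_det e).ne_zero, ?_⟩
  have := prod_eq_prod_mul_sq_of_basis h2 he hf
  have h1 : ∏ i, q (f i) = ∏ i, q (e' i) := by
    refine Fintype.prod_equiv (finCongr hlen).symm _ _ fun i => ?_
    simp [f]
  rw [h1] at this
  simp only [hq, hq'] at this
  rw [← List.prod_ofFn, ← List.prod_ofFn, List.ofFn_get, List.ofFn_get] at this
  exact this

end Diagonal

/-! ### Diagonalizing lattices -/

section Jordan

open QuadraticMap IsLocalRing

variable {k : Type*} [Field k] {O : Type*} [CommRing O] [Algebra O k]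

/-- The list of the values `s * u`, for `u` in a list of units. -/
abbrev scaledUnits (s : k) (us : List Oˣ) : List k :=
  us.map fun u : Oˣ => s * algebraMap O k u

theorem prod_scaledUnits (s : k) (us : List Oˣ) :
    (scaledUnits s us).prod = algebraMap O k (us.prod : Oˣ) * s ^ us.length := by
  induction us with
  | nil => simp
  | cons u us ih =>
    rw [scaledUnits, List.map_cons, List.prod_cons, ← scaledUnits, ih, List.prod_cons,
      Units.val_mul, map_mul, List.length_cons]
    ring

variable {V : Type*} [AddCommGroup V] [Module k V] [Module O V] [IsScalarTower O k V]
  {q : QuadraticForm k V}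

/-- A replacement `x, y ↦ α x + β y, -b β x + a α y` of two orthogonal vectors with
`q x = s a`, `q y = s b`. -/
theorem span_sup_span_eq_of_isUnit {x y : V} {a b α β : O} (h : IsUnit (a * α ^ 2 + b * β ^ 2)) :
    (O ∙ (α • x + β • y)) ⊔ (O ∙ (-(b * β) • x + (a * α) • y)) = (O ∙ x) ⊔ (O ∙ y) := by
  have hx := Submodule.mem_sup_left (S := O ∙ x) (T := O ∙ y) (Submodule.mem_span_singleton_self x)
  have hy := Submodule.mem_sup_right (S := O ∙ x) (T := O ∙ y) (Submodule.mem_span_singleton_self y)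
  apply le_antisymm
  · refine sup_le ?_ ?_ <;> rw [Submodule.span_singleton_le_iff_mem] <;>
      exact add_mem (Submodule.smul_mem _ _ hx) (Submodule.smul_mem _ _ hy)
  · set f := α • x + β • y with hf
    set g := -(b * β) • x + (a * α) • y with hg
    have hf' := Submodule.mem_sup_left (S := O ∙ f) (T := O ∙ g)
      (Submodule.mem_span_singleton_self f)
    have hg' := Submodule.mem_sup_right (S := O ∙ f) (T := O ∙ g)
      (Submodule.mem_span_singleton_self g)
    obtain ⟨u, hu⟩ := h
    refine sup_le ?_ ?_ <;> rw [Submodule.span_singleton_le_iff_mem]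
    · have : x = (↑u⁻¹ : O) • ((a * α) • f + (-β) • g) := by
        have h1 : (a * α) • f + (-β) • g = (u : O) • x := by rw [hf, hg, hu]; module
        rw [h1, smul_smul, Units.inv_mul, one_smul]
      rw [this]
      exact Submodule.smul_mem _ _
        (add_mem (Submodule.smul_mem _ _ hf') (Submodule.smul_mem _ _ hg'))
    · have : y = (↑u⁻¹ : O) • ((b * β) • f + α • g) := by
        have h1 : (b * β) • f + α • g = (u : O) • y := by rw [hf, hg, hu]; module
        rw [h1, smul_smul, Units.inv_mul, one_smul]
      rw [this]
      exact Submodule.smul_mem _ _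
        (add_mem (Submodule.smul_mem _ _ hf') (Submodule.smul_mem _ _ hg'))

theorem map_smul_add_smul_of_polar_eq_zero {x y : V} (h : polar q x y = 0) (α β : O) :
    q (α • x + β • y) = algebraMap O k (α ^ 2) * q x + algebraMap O k (β ^ 2) * q y := by
  rw [QuadraticMap.map_add q, polar_smul_left_of_tower, polar_smul_right_of_tower, h,
    QuadraticMap.map_smul_of_tower, QuadraticMap.map_smul_of_tower, Algebra.smul_def,
    Algebra.smul_def, pow_two, pow_two]
  simp

/-- Unimodular diagonal forms over `O` (and their multiples by a scalar `s`) are classified by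
their rank and their determinant modulo squares. -/
theorem IsDiagonal.change_units [HenselianLocalRing O] [Finite (ResidueField O)]
    (hk : ringChar (ResidueField O) ≠ 2) (s : k) {us us' : List Oˣ}
    (hlen : us.length = us'.length) (hprod : ∃ c : Oˣ, us.prod = us'.prod * c ^ 2)
    {L : Submodule O V} (h : IsDiagonal q (scaledUnits s us) L) :
    IsDiagonal q (scaledUnits s us') L := by
  induction us' generalizing us L with
  | nil =>
    obtain rfl := List.length_eq_zero_iff.1 hlen
    exact h
  | cons a' r' ih =>
    obtain ⟨c, hc⟩ := hprod
    match us, hlen, hc, h with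
    | [a], hlen, hc, hd =>
      obtain rfl : r' = [] := List.length_eq_zero_iff.1 (by simpa using hlen.symm)
      obtain ⟨x, M, hx, hM, hd, rfl⟩ := hd
      beta_reduce at hx
      refine ⟨(↑c⁻¹ : O) • x, M, ?_, fun y hy => ?_, hd, ?_⟩
      · beta_reduce
        rw [QuadraticMap.map_smul_of_tower, hx, Algebra.smul_def]
        have : (a : O) = a' * c ^ 2 := by simpa using congrArg Units.val hc
        rw [this]
        have h1 : algebraMap O k (↑c⁻¹ : O) * algebraMap O k c = 1 := by rw [← map_mul]; simp
        simp only [map_mul, map_pow]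
        linear_combination (s * algebraMap O k a') *
          (algebraMap O k (↑c⁻¹ : O) * algebraMap O k c + 1) * h1
      · rw [polar_smul_left_of_tower, hM y hy, smul_zero]
      · rw [Submodule.span_singleton_smul_eq (Units.isUnit _)]
    | a :: b :: r, hlen, hc, hd =>
      obtain ⟨x, _, hx, hM, ⟨y, M, hy, hM', hd, rfl⟩, rfl⟩ := hd
      beta_reduce at hx hy
      obtain ⟨α, β, hαβ⟩ := exists_mul_sq_add_mul_sq_eq hk a b a'
      have hxy : polar q x y = 0 :=
        hM y (Submodule.mem_sup_left (Submodule.mem_span_singleton_self y))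
      have hxM : ∀ z ∈ M, polar q x z = 0 := fun z hz => hM z (Submodule.mem_sup_right hz)
      have hαβ' := congrArg (algebraMap O k) hαβ
      simp only [map_add, map_mul, map_pow] at hαβ'
      refine ⟨α • x + β • y, (O ∙ (-(b * β : O) • x + (a * α : O) • y)) ⊔ M, ?_, fun z hz => ?_,
        ih (us := a * b * a' :: r) (by simpa using hlen) ⟨a' * c, ?_⟩
          ⟨_, M, ?_, fun z hz => ?_, hd, rfl⟩, ?_⟩
      · beta_reduce
        rw [map_smul_add_smul_of_polar_eq_zero hxy, hx, hy, ← hαβ']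
        simp only [map_pow]
        ring
      · refine polar_eq_zero_of_mem_sup (fun w hw => ?_) (fun w hw => ?_) hz
        · rw [polar_comm]
          refine polar_eq_zero_of_mem_span_singleton ?_ hw
          simp only [polar_add_left, polar_add_right, polar_smul_left_of_tower,
            polar_smul_right_of_tower, polar_self_eq, polar_comm q y x, hxy, hx, hy,
            Algebra.smul_def, map_mul, map_neg]
          ring
        · rw [polar_add_left, polar_smul_left_of_tower, polar_smul_left_of_tower, hxM w hw,
            hM' w hw, smul_zero, smul_zero, add_zero]
      · simp only [List.prod_cons] at hc ⊢
        have h1 : a * b * a' * r.prod = a' * (a * (b * r.prod)) := by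
          simp only [mul_assoc, mul_comm]
        rw [h1, hc]
        simp only [pow_two, mul_assoc, mul_comm, mul_left_comm]
      · beta_reduce
        rw [map_smul_add_smul_of_polar_eq_zero hxy, hx, hy]
        simp only [map_pow, map_mul, map_neg, Units.val_mul, ← hαβ']
        ring
      · rw [polar_add_left, polar_smul_left_of_tower, polar_smul_left_of_tower, hxM z hz,
          hM' z hz, smul_zero, smul_zero, add_zero]
      · rw [← sup_assoc, ← sup_assoc, span_sup_span_eq_of_isUnit (by rw [hαβ]; exact a'.isUnit)]

/-- A lattice on which `q` is integral and nondegenerate has an orthogonal basis: a vector whose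
value `q x` has least valuation splits off. -/
theorem exists_isDiagonal [IsDomain O] [IsDiscreteValuationRing O] [IsFractionRing O k]
    [FiniteDimensional k V]
    (h2 : IsUnit (2 : O)) (L : Submodule O V) (hint : ∀ x ∈ L, ∃ a : O, algebraMap O k a = q x)
    (hrad : ∀ x ∈ L, (∀ y ∈ L, polar q x y = 0) → x = 0) :
    ∃ l : List k, (∀ a ∈ l, a ≠ 0) ∧ IsDiagonal q l L := by
  have h2k : (2 : k) ≠ 0 := by
    rw [← map_ofNat (algebraMap O k) 2]
    exact (h2.map (algebraMap O k)).ne_zero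
  induction hn : Module.finrank k (Submodule.span k (L : Set V)) using Nat.strong_induction_on
    generalizing L with
  | _ n ih =>
  subst hn
  by_cases h0 : ∀ x ∈ L, q x = 0
  · refine ⟨[], by simp, (Submodule.eq_bot_iff _).2 fun x hx => hrad x hx fun y hy => ?_⟩
    rw [polar, h0 _ (add_mem hx hy), h0 x hx, h0 y hy]
    simp
  push Not at h0
  choose! f hf using hint
  obtain ⟨_, ⟨x, hx, rfl⟩, hmin⟩ := WellFounded.has_min (wellFounded_lt (α := ℕ∞))
    ((fun x => IsDiscreteValuationRing.addVal O (f x)) '' (L : Set V)) ⟨_, 0, L.zero_mem, rfl⟩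
  have hdvd : ∀ y ∈ L, f x ∣ f y := fun y hy =>
    IsDiscreteValuationRing.addVal_le_iff_dvd.1 (not_lt.1 (hmin _ ⟨y, hy, rfl⟩))
  have hqx : q x ≠ 0 := by
    obtain ⟨y, hy, hqy⟩ := h0
    intro hqx
    apply hqy
    obtain ⟨t, ht⟩ := hdvd y hy
    rw [← hf y hy, ht, map_mul, hf x hx, hqx, zero_mul]
  have hxx : polar q x x ≠ 0 := by
    rw [polar_self_eq]
    exact mul_ne_zero h2k hqx
  let M : Submodule O V := L ⊓ (LinearMap.ker (q.polarBilin x)).restrictScalars O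
  have hM : ∀ y, y ∈ M ↔ y ∈ L ∧ polar q x y = 0 := fun y => by
    simp [M, LinearMap.mem_ker]
  have hLM : L = O ∙ x ⊔ M := by
    apply le_antisymm
    · intro y hy
      obtain ⟨t, ht⟩ : f x ∣ f (x + y) - f x - f y :=
        dvd_sub (dvd_sub (hdvd _ (add_mem hx hy)) dvd_rfl) (hdvd y hy)
      obtain ⟨r, hr⟩ := h2.dvd (a := t)
      have hp : polar q x y = algebraMap O k (2 * r) * q x := by
        rw [polar, ← hf _ (add_mem hx hy), ← hf x hx, ← hf y hy, ← map_sub, ← map_sub, ht, hr,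
          map_mul, mul_comm]
      rw [Submodule.mem_sup]
      refine ⟨r • x, Submodule.smul_mem _ _ (Submodule.mem_span_singleton_self x), y - r • x,
        (hM _).2 ⟨sub_mem hy (Submodule.smul_mem _ _ hx), ?_⟩, by abel⟩
      rw [polar_sub_right, polar_smul_right_of_tower, hp, polar_self_eq, Algebra.smul_def]
      simp only [map_mul, map_ofNat]
      ring
    · exact sup_le ((Submodule.span_singleton_le_iff_mem ..).2 hx) inf_le_left
  have hlt : Module.finrank k (Submodule.span k (M : Set V)) <
      Module.finrank k (Submodule.span k (L : Set V)) := by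
    refine Submodule.finrank_lt_finrank_of_lt (lt_of_le_of_ne (Submodule.span_mono
      (fun y hy => ((hM y).1 hy).1)) fun h => hxx ?_)
    have h1 : x ∈ Submodule.span k (M : Set V) := by
      rw [h]
      exact Submodule.subset_span hx
    exact polar_eq_zero_of_mem_span (fun y hy => ((hM y).1 hy).2) h1
  obtain ⟨l, hl, h⟩ := ih _ hlt M (fun y hy => ⟨f y, hf y ((hM y).1 hy).1⟩)
    (fun y hy hyM => hrad y ((hM y).1 hy).1 fun z hz => by
      rw [hLM] at hz
      refine polar_eq_zero_of_mem_sup (fun w hw => ?_) hyM hz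
      rw [polar_comm]
      exact polar_eq_zero_of_mem_span_singleton ((hM y).1 hy).2 hw) rfl
  exact ⟨q x :: l, by simpa [hqx] using hl, x, M, rfl, fun y hy => ((hM y).1 hy).2, h, hLM⟩

end Jordan

/-! ### Representing a quadratic space by a lattice -/

section Existence

open QuadraticMap IsLocalRing

variable {k : Type*} [Field k] {V : Type*} [AddCommGroup V] [Module k V] {q : QuadraticForm k V}

/-- Over the field, `⟨s, -s⟩` is a hyperbolic plane, so that it does not depend on `s`. -/
theorem IsDiagonal.hyperbolic (h2 : (2 : k) ≠ 0) {s : k} (hs : s ≠ 0) {l : List k}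
    {W : Submodule k V} (h : IsDiagonal q (s :: -s :: l) W) : IsDiagonal q (1 :: -1 :: l) W := by
  obtain ⟨x, _, hx, hM, ⟨y, M, hy, hM', h, rfl⟩, rfl⟩ := h
  have hxy : polar q x y = 0 :=
    hM y (Submodule.mem_sup_left (Submodule.mem_span_singleton_self y))
  have hxM : ∀ z ∈ M, polar q x z = 0 := fun z hz => hM z (Submodule.mem_sup_right hz)
  -- with the isotropic vectors `A = x + y` and `B = x - y`, the new basis is
  -- `A / (4 s) + B` and `A / (4 s) - B`
  set α : k := 1 / (4 * s) + 1 with hα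
  set β : k := 1 / (4 * s) - 1 with hβ
  have h4 : (4 : k) ≠ 0 := by
    have : (4 : k) = 2 * 2 := by norm_num
    rw [this]
    exact mul_ne_zero h2 h2
  have hdet : α ^ 2 - β ^ 2 = 1 / s := by
    rw [hα, hβ]
    field_simp
    ring
  have hspan : (k ∙ (α • x + β • y)) ⊔ (k ∙ (β • x + α • y)) = (k ∙ x) ⊔ (k ∙ y) := by
    have := span_sup_span_eq_of_isUnit (O := k) (x := x) (y := y) (a := 1) (b := -1) (α := α)
      (β := β) (isUnit_iff_ne_zero.2 (by
        rw [one_mul, neg_one_mul, ← sub_eq_add_neg, hdet]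
        exact one_div_ne_zero hs))
    simpa using this
  refine ⟨α • x + β • y, (k ∙ (β • x + α • y)) ⊔ M, ?_, fun z hz => ?_,
    ⟨β • x + α • y, M, ?_, fun z hz => ?_, h, rfl⟩, ?_⟩
  · rw [map_smul_add_smul_of_polar_eq_zero hxy, hx, hy]
    simp only [Algebra.algebraMap_self, RingHom.id_apply]
    have : α ^ 2 * s + β ^ 2 * -s = (α ^ 2 - β ^ 2) * s := by ring
    rw [this, hdet, one_div_mul_cancel hs]
  · refine polar_eq_zero_of_mem_sup (fun w hw => ?_) (fun w hw => ?_) hz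
    · rw [polar_comm]
      refine polar_eq_zero_of_mem_span_singleton ?_ hw
      simp only [polar_add_left, polar_add_right, polar_smul_left,
        polar_smul_right, polar_self_eq, polar_comm q y x, hxy, hx, hy, smul_eq_mul]
      ring
    · rw [polar_add_left, polar_smul_left, polar_smul_left, hxM w hw, hM' w hw, smul_zero,
        smul_zero, add_zero]
  · rw [map_smul_add_smul_of_polar_eq_zero hxy, hx, hy]
    simp only [Algebra.algebraMap_self, RingHom.id_apply]
    have : β ^ 2 * s + α ^ 2 * -s = -((α ^ 2 - β ^ 2) * s) := by ring
    rw [this, hdet, one_div_mul_cancel hs]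
  · rw [polar_add_left, polar_smul_left, polar_smul_left, hxM z hz, hM' z hz, smul_zero,
      smul_zero, add_zero]
  · rw [← sup_assoc, ← sup_assoc, hspan]

end Existence

/-! ### The Hasse-Witt invariant of a diagonal form -/

section HasseWitt

open QuadraticMap IsLocalRing

variable {k : Type*} [Field k] {V : Type*} [AddCommGroup V] [Module k V] {q : QuadraticForm k V}

/-- The product of the Hilbert symbols `(a, b)` over the pairs `a` before `b` of a list. -/
noncomputable def hasseWitt : List k → ℤˣ
  | [] => 1
  | a :: l => (l.map (hilbertSymbol a)).prod * hasseWitt l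

theorem prod_prod_Ioi_hilbertSymbol {n : ℕ} (f : Fin n → k) :
    ∏ i, ∏ j ∈ Finset.Ioi i, hilbertSymbol (f i) (f j) = hasseWitt (List.ofFn f) := by
  induction n with
  | zero => simp [hasseWitt]
  | succ n ih =>
    rw [Fin.prod_univ_succ, Fin.prod_Ioi_zero, List.ofFn_succ, hasseWitt, ← ih, List.map_ofFn,
      List.prod_ofFn]
    simp only [Fin.prod_Ioi_succ]
    rfl

theorem IsDiagonal.of_mul_sq {a c : k} (hc : c ≠ 0) {l : List k} {W : Submodule k V}
    (h : IsDiagonal q (a * c ^ 2 :: l) W) : IsDiagonal q (a :: l) W := by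
  obtain ⟨x, M, hx, hM, h, rfl⟩ := h
  refine ⟨c⁻¹ • x, M, ?_, fun y hy => ?_, h, ?_⟩
  · rw [QuadraticMap.map_smul, hx, smul_eq_mul]
    field_simp
  · rw [polar_smul_left, hM y hy, smul_zero]
  · rw [Submodule.span_singleton_smul_eq (inv_ne_zero hc).isUnit]

/-- A diagonal change of units over `O` can be made over `k`. -/
theorem IsDiagonal.change_units_field {O : Type*} [CommRing O]
    [HenselianLocalRing O] [Finite (ResidueField O)] [Algebra O k]
    (hk : ringChar (ResidueField O) ≠ 2) (s : k) {us us' : List Oˣ}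
    (hlen : us.length = us'.length) (hprod : ∃ c : Oˣ, us.prod = us'.prod * c ^ 2)
    {W : Submodule k V} (h : IsDiagonal q (scaledUnits s us) W) :
    IsDiagonal q (scaledUnits s us') W := by
  let : Module O V := Module.compHom V (algebraMap O k)
  have : IsScalarTower O k V := ⟨fun a b v => by
    rw [Algebra.smul_def, mul_smul]; rfl⟩
  obtain ⟨L, hL, rfl⟩ := h.exists_span_eq O
  exact (hL.change_units hk s hlen hprod).span

variable {O : Type*} [CommRing O] [IsDomain O] [IsDiscreteValuationRing O] [Algebra O k]
  [IsFractionRing O k] [HenselianLocalRing O] [Finite (ResidueField O)]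

/-- Every diagonal form is, up to squares, of the form `⟨us⟩ ⊥ ϖ ⟨vs⟩` with units `us`, `vs`, and
its Hasse-Witt invariant is given by the quadratic characters of these units. The last two
clauses give the product of the Hilbert symbols of a further element with the members of `l`, and
carry the induction. -/
theorem exists_units_of_list (hk : ringChar (ResidueField O) ≠ 2) {ϖ : O} (hϖ : Irreducible ϖ)
    (q : QuadraticForm k V) (l : List k) (hl : ∀ a ∈ l, a ≠ 0) :
    ∃ us vs : List Oˣ,
      (∀ W : Submodule k V, IsDiagonal q l W →
        IsDiagonal q (scaledUnits 1 us ++ scaledUnits (algebraMap O k ϖ) vs) W) ∧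
      (∃ c : k, c ≠ 0 ∧ l.prod =
        algebraMap O k (us.prod * vs.prod : Oˣ) * algebraMap O k ϖ ^ vs.length * c ^ 2) ∧
      hasseWitt l = unitsQuadraticChar O (us.prod * vs.prod) ^ vs.length *
        unitsQuadraticChar O vs.prod * unitsQuadraticChar O (-1) ^ vs.length.choose 2 ∧
      (∀ u : Oˣ, (l.map (hilbertSymbol (algebraMap O k u))).prod =
        unitsQuadraticChar O u ^ vs.length) ∧
      (∀ u : Oˣ, (l.map (hilbertSymbol (algebraMap O k (ϖ * u)))).prod =
        unitsQuadraticChar O (us.prod * vs.prod) * unitsQuadraticChar O (-u) ^ vs.length) := by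
  induction l with
  | nil => exact ⟨[], [], fun W h => h, ⟨1, by simp⟩, by simp [hasseWitt], by simp, by simp⟩
  | cons a l ih =>
    obtain ⟨us, vs, h₁, ⟨c, hc, h₂⟩, h₃, h₄, h₅⟩ := ih fun b hb => hl b (List.mem_cons_of_mem _ hb)
    obtain ⟨u, d, hd, h | h⟩ := exists_eq_unit_mul_sq_or hϖ (hl a List.mem_cons_self)
    · refine ⟨u :: us, vs, fun W hW => ?_, ⟨c * d, mul_ne_zero hc hd, ?_⟩, ?_, fun v => ?_,
        fun v => ?_⟩
      · rw [h] at hW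
        obtain ⟨x, M, hx, hM, hW', rfl⟩ := hW.of_mul_sq hd
        exact ⟨x, M, by simpa using hx, hM, h₁ M hW', rfl⟩
      · rw [List.prod_cons, List.prod_cons, h₂, h, mul_assoc u,
          Units.val_mul u, map_mul _ (u : O)]
        ring
      · have : hilbertSymbol a = hilbertSymbol (algebraMap O k u) := by
          ext b; rw [h, hilbertSymbol_mul_sq_left _ _ hd]
        rw [hasseWitt, this, h₃, h₄, List.prod_cons, mul_assoc u, map_mul _ u, mul_pow]
        simp only [mul_assoc]
      · rw [List.map_cons, List.prod_cons, h₄, h, hilbertSymbol_mul_sq_right _ _ hd,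
          hilbertSymbol_unit_unit hk, one_mul]
      · rw [List.map_cons, List.prod_cons, h₅, h, hilbertSymbol_mul_sq_right _ _ hd,
          hilbertSymbol_uniformizer_mul_unit_unit hk hϖ, List.prod_cons, mul_assoc u, map_mul _ u,
          mul_assoc]
    · refine ⟨us, u :: vs, fun W hW => ?_, ⟨c * d, mul_ne_zero hc hd, ?_⟩, ?_, fun v => ?_,
        fun v => ?_⟩
      · rw [h] at hW
        refine IsDiagonal.perm List.perm_middle.symm ?_
        obtain ⟨x, M, hx, hM, hW', rfl⟩ := hW.of_mul_sq hd
        exact ⟨x, M, by simpa using hx, hM, h₁ M hW', rfl⟩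
      · rw [List.prod_cons, List.prod_cons, h₂, h, mul_left_comm us.prod,
          Units.val_mul u, map_mul _ (u : O), map_mul _ ϖ, List.length_cons]
        ring
      · have : hilbertSymbol a = hilbertSymbol (algebraMap O k (ϖ * u)) := by
          ext b; rw [h, hilbertSymbol_mul_sq_left _ _ hd]
        rw [hasseWitt, this, h₃, h₅, List.prod_cons, List.length_cons, ← neg_one_mul u]
        rw [mul_left_comm us.prod, Nat.choose_succ_succ' _ 1, Nat.choose_one_right]
        simp only [map_mul, mul_pow, pow_add, pow_one]
        have hu := unitsQuadraticChar_sq u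
        generalize unitsQuadraticChar O u = x at *
        rw [pow_two] at hu
        generalize unitsQuadraticChar O us.prod = y
        generalize unitsQuadraticChar O vs.prod = z
        generalize unitsQuadraticChar O (-1) ^ vs.length.choose 2 = t
        generalize unitsQuadraticChar O (-1) ^ vs.length = t'
        generalize x ^ vs.length = x'
        generalize y ^ vs.length = y'
        generalize z ^ vs.length = z'
        calc _ = y * z * (t' * x') * (y' * z' * z * t) * 1 := by rw [mul_one]
          _ = y * z * (t' * x') * (y' * z' * z * t) * (x * x) := by rw [hu]
          _ = _ := by ac_rfl
      · rw [List.map_cons, List.prod_cons, h₄, h, hilbertSymbol_mul_sq_right _ _ hd,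
          hilbertSymbol_comm, hilbertSymbol_uniformizer_mul_unit_unit hk hϖ, List.length_cons,
          pow_succ']
      · rw [List.map_cons, List.prod_cons, h₅, h, hilbertSymbol_mul_sq_right _ _ hd,
          hilbertSymbol_uniformizer_mul_unit_uniformizer_mul_unit hk hϖ, List.prod_cons,
          List.length_cons, ← neg_mul, mul_left_comm us.prod, map_mul _ (-v),
          map_mul _ u, pow_succ']
        ac_rfl

/-- The list `1, -1, 1, -1, …` of length `2 t`. -/
def alternatingUnits (O : Type*) [CommRing O] : ℕ → List Oˣ
  | 0 => []
  | t + 1 => 1 :: -1 :: alternatingUnits O t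

theorem length_alternatingUnits {O : Type*} [CommRing O] (t : ℕ) :
    (alternatingUnits O t).length = 2 * t := by
  induction t with
  | zero => rfl
  | succ t ih => simp [alternatingUnits, ih]; ring

theorem prod_alternatingUnits {O : Type*} [CommRing O] (t : ℕ) :
    (alternatingUnits O t).prod = (-1) ^ t := by
  induction t with
  | zero => simp [alternatingUnits]
  | succ t ih => simp [alternatingUnits, ih, pow_succ]

theorem IsDiagonal.alternatingUnits {O : Type*} [CommRing O] [Algebra O k] (h2 : (2 : k) ≠ 0)
    {s : k} (hs : s ≠ 0) (t : ℕ) {W : Submodule k V}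
    (h : IsDiagonal q (scaledUnits s (alternatingUnits O t)) W) :
    IsDiagonal q (scaledUnits 1 (OrthogonalLattice.alternatingUnits O t)) W := by
  induction t generalizing W with
  | zero => exact h
  | succ t ih =>
    have h' := IsDiagonal.hyperbolic h2 hs
      (l := scaledUnits s (OrthogonalLattice.alternatingUnits O t)) (W := W)
      (by simpa [OrthogonalLattice.alternatingUnits] using h)
    obtain ⟨x, _, hx, hM, ⟨y, M, hy, hM', h₀, rfl⟩, rfl⟩ := h'
    exact ⟨x, _, by simpa using hx, hM, ⟨y, M, by simpa using hy, hM', ih h₀, rfl⟩, rfl⟩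

/-- A quadratic space whose determinant is a unit is either unimodular or the sum of a unimodular
space and `ϖ ⟨1, -δ⟩` with `δ` a non-square unit, according to its Hasse-Witt invariant. -/
theorem exists_isDiagonal_of_hasseWitt (hk : ringChar (ResidueField O) ≠ 2) {ϖ : O}
    (hϖ : Irreducible ϖ) {l : List k} (hl : ∀ a ∈ l, a ≠ 0) {W : Submodule k V}
    (h : IsDiagonal q l W) (hd : ∃ (u : Oˣ) (c : k), c ≠ 0 ∧ l.prod = algebraMap O k u * c ^ 2) :
    (hasseWitt l = 1 → ∃ us : List Oˣ, IsDiagonal q (scaledUnits 1 us) W) ∧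
    (hasseWitt l = -1 → ∃ (us : List Oˣ) (δ : Oˣ), unitsQuadraticChar O δ = -1 ∧
      IsDiagonal q (scaledUnits 1 us ++ scaledUnits (algebraMap O k ϖ) [1, -δ]) W) := by
  have h2 : (2 : k) ≠ 0 := by
    rw [← map_ofNat (algebraMap O k) 2]
    exact ((isUnit_two_of_ringChar_residueField_ne_two hk).map (algebraMap O k)).ne_zero
  have hϖ0 : algebraMap O k ϖ ≠ 0 := by
    rw [map_ne_zero_iff _ (IsFractionRing.injective O k)]
    exact hϖ.ne_zero
  obtain ⟨us, vs, hus, ⟨c, hc, hprod⟩, hhw, -, -⟩ := exists_units_of_list hk hϖ q l hl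
  -- the determinant is a unit, so that the number of odd entries is even
  obtain ⟨t, ht⟩ : Even vs.length := by
    obtain ⟨u, d, -, hd⟩ := hd
    exact even_of_unit_mul_pow_mul_sq_eq hϖ hc (hprod.symm.trans hd)
  rw [← two_mul] at ht
  set δ : Oˣ := (-1) ^ t * vs.prod with hδ
  have hhw' : hasseWitt l = unitsQuadraticChar O δ := by
    have h1 : (2 * t).choose 2 = t * (2 * t - 1) := by
      rw [Nat.choose_two_right, mul_assoc, Nat.mul_div_cancel_left _ two_pos]
    have h2 : unitsQuadraticChar O (-1) ^ (t * (2 * t - 1)) = unitsQuadraticChar O (-1) ^ t := by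
      rcases t with _ | t
      · rfl
      · rw [mul_comm, pow_mul, show 2 * (t + 1) - 1 = 2 * t + 1 by omega, pow_succ (_ : ℤˣ) (2 * t),
          pow_mul _ 2, unitsQuadraticChar_sq, one_pow, one_mul]
    rw [hhw, ht, h1, h2, pow_mul, unitsQuadraticChar_sq, one_pow, one_mul, hδ, map_mul, map_pow,
      mul_comm]
  obtain ⟨L₁, L₂, hL₁, hL₂, h₁₂, rfl⟩ := isDiagonal_append.1 (hus W h)
  have hvs : vs.prod = (-1) ^ t * δ := by
    rw [hδ, ← mul_assoc, ← mul_pow]; simp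
  rw [hhw']
  constructor
  · intro h1
    obtain ⟨b, hb⟩ := (unitsQuadraticChar_eq_one_iff hk).1 h1
    refine ⟨us ++ alternatingUnits O t, ?_⟩
    rw [scaledUnits, List.map_append]
    refine isDiagonal_append.2 ⟨L₁, L₂, hL₁, IsDiagonal.alternatingUnits h2 hϖ0 t
      (hL₂.change_units_field hk _ ?_ ⟨b, ?_⟩), h₁₂, rfl⟩
    · rw [ht, length_alternatingUnits]
    · rw [hvs, prod_alternatingUnits, hb]
  · intro h1
    obtain _ | t := t
    · obtain rfl : vs = [] := List.length_eq_zero_iff.1 (by simpa using ht)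
      rw [hδ] at h1
      exact absurd h1 (by simp)
    · have h3 := hL₂.change_units_field hk _ (us' := alternatingUnits O t ++ [1, -δ])
        (by rw [ht, List.length_append, length_alternatingUnits]; simp; ring)
        ⟨1, by rw [hvs, List.prod_append, prod_alternatingUnits]; simp [pow_succ]⟩
      rw [scaledUnits, List.map_append] at h3
      obtain ⟨M₁, M₂, hM₁, hM₂, hM, rfl⟩ := isDiagonal_append.1 h3
      refine ⟨us ++ alternatingUnits O t, δ, h1, ?_⟩
      rw [scaledUnits, List.map_append, List.append_assoc]
      exact isDiagonal_append.2 ⟨L₁, M₁ ⊔ M₂, hL₁, isDiagonal_append.2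
        ⟨M₁, M₂, IsDiagonal.alternatingUnits h2 hϖ0 t hM₁, hM₂, hM, rfl⟩, h₁₂, rfl⟩

end HasseWitt

/-! ### Dual lattices -/

section Dual

open QuadraticMap IsLocalRing

variable {k : Type*} [Field k] {V : Type*} [AddCommGroup V] [Module k V] {q : QuadraticForm k V}

theorem IsOrthogonalBasis.polar_eq {ι : Type*} {e : Module.Basis ι k V}
    (he : IsOrthogonalBasis q e) (x : V) (i : ι) :
    polar q x (e i) = 2 * q (e i) * e.repr x i := by
  classical
  have h : q.polarBilin.flip (e i) = (2 * q (e i)) • e.coord i := by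
    refine e.ext fun j => ?_
    rw [LinearMap.flip_apply, polarBilin_apply_apply, LinearMap.smul_apply,
      Module.Basis.coord_apply, Module.Basis.repr_self, smul_eq_mul]
    by_cases hij : j = i
    · subst hij
      rw [polar_self_eq, Finsupp.single_eq_same, mul_one]
    · rw [he j i hij, Finsupp.single_eq_of_ne' hij, mul_zero]
  exact LinearMap.congr_fun h x

theorem IsOrthogonalBasis.apply_eq_sum {ι : Type*} [Fintype ι] (h2 : (2 : k) ≠ 0)
    {e : Module.Basis ι k V} (he : IsOrthogonalBasis q e) (x : V) :
    q x = ∑ i, q (e i) * e.repr x i ^ 2 := by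
  apply mul_left_cancel₀ h2
  rw [← polar_self_eq]
  conv_lhs => rw [← polarBilin_apply_apply]; arg 2; rw [← e.sum_repr x]
  rw [map_sum, Finset.mul_sum]
  refine Finset.sum_congr rfl fun i _ => ?_
  rw [map_smul, polarBilin_apply_apply, he.polar_eq, smul_eq_mul]
  ring

variable {O : Type*} [CommRing O] [Algebra O k]

theorem two_ne_zero_of_isUnit (h2 : IsUnit (2 : O)) : (2 : k) ≠ 0 := by
  rw [← map_ofNat (algebraMap O k) 2]
  exact (h2.map (algebraMap O k)).ne_zero

theorem algebraMap_unit_ne_zero (u : Oˣ) : algebraMap O k u ≠ 0 :=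
  (u.isUnit.map (algebraMap O k)).ne_zero

theorem scaledUnits_ne_zero {s : k} (hs : s ≠ 0) (us : List Oˣ) :
    ∀ a ∈ scaledUnits s us, a ≠ 0 := by
  intro a ha
  obtain ⟨u, -, rfl⟩ := List.mem_map.1 ha
  exact mul_ne_zero hs (algebraMap_unit_ne_zero u)

variable [Module O V] [IsScalarTower O k V]

/-- In the coordinates of an orthogonal basis the dual lattice is given by conditions on the single
coordinates. -/
theorem IsOrthogonalBasis.mem_dualSubmodule_iff (h2 : IsUnit (2 : O)) {ι : Type*}
    {e : Module.Basis ι k V} (he : IsOrthogonalBasis q e) {x : V} :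
    x ∈ LinearMap.BilinForm.dualSubmodule q.polarBilin (Submodule.span O (Set.range e)) ↔
      ∀ i, q (e i) * e.repr x i ∈ Set.range (algebraMap O k) := by
  rw [LinearMap.BilinForm.mem_dualSubmodule]
  obtain ⟨u, hu⟩ := h2
  constructor
  · intro h i
    obtain ⟨a, ha⟩ := Submodule.mem_one.1 (h (e i) (Submodule.subset_span ⟨i, rfl⟩))
    rw [polarBilin_apply_apply, he.polar_eq] at ha
    refine ⟨↑u⁻¹ * a, ?_⟩
    have h1 : algebraMap O k (↑u⁻¹ : O) * 2 = 1 := by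
      rw [← map_ofNat (algebraMap O k) 2, ← hu, ← map_mul]; simp
    rw [map_mul, ha]
    linear_combination q (e i) * e.repr x i * h1
  · intro h y hy
    induction hy using Submodule.span_induction with
    | mem y hy =>
      obtain ⟨i, rfl⟩ := hy
      obtain ⟨a, ha⟩ := h i
      refine Submodule.mem_one.2 ⟨2 * a, ?_⟩
      rw [polarBilin_apply_apply, he.polar_eq, map_mul, ha, map_ofNat]
      ring
    | zero => rw [map_zero]; exact zero_mem _
    | add a b _ _ ha hb => rw [map_add]; exact add_mem ha hb
    | smul c a _ ha =>
      rw [← algebraMap_smul k c a, map_smul, algebraMap_smul]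
      exact Submodule.smul_mem _ _ ha

variable [IsDomain O] [IsFractionRing O k]

theorem IsDiagonal.dualSubmodule_eq (h2 : IsUnit (2 : O)) {us : List Oˣ} {L : Submodule O V}
    (h : IsDiagonal q (scaledUnits 1 us) L) (hL : Submodule.span k (L : Set V) = ⊤) :
    LinearMap.BilinForm.dualSubmodule q.polarBilin L = L := by
  have hinj : Function.Injective (algebraMap O k) := IsFractionRing.injective O k
  have : FaithfulSMul O k := (faithfulSMul_iff_algebraMap_injective O k).2 hinj
  obtain ⟨e, he, hq, rfl⟩ := h.exists_basis (two_ne_zero_of_isUnit h2)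
    (scaledUnits_ne_zero one_ne_zero us) hL
  ext x
  rw [he.mem_dualSubmodule_iff h2, e.mem_span_iff_repr_mem O]
  refine forall_congr' fun i => ?_
  obtain ⟨u, -, hu⟩ := List.mem_map.1 (List.get_mem (scaledUnits (1 : k) us) i)
  rw [hq, ← hu, one_mul]
  constructor
  · rintro ⟨a, ha⟩
    refine ⟨↑u⁻¹ * a, ?_⟩
    rw [map_mul, ha, ← mul_assoc, ← map_mul]
    simp
  · rintro ⟨a, ha⟩
    exact ⟨u * a, by rw [map_mul, ha]⟩

theorem IsDiagonal.le_dualSubmodule (h2 : IsUnit (2 : O)) {l : List k} (hl : ∀ a ∈ l, a ≠ 0)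
    (hint : ∀ a ∈ l, a ∈ Set.range (algebraMap O k)) {L : Submodule O V} (h : IsDiagonal q l L)
    (hL : Submodule.span k (L : Set V) = ⊤) :
    L ≤ LinearMap.BilinForm.dualSubmodule q.polarBilin L := by
  have hinj : Function.Injective (algebraMap O k) := IsFractionRing.injective O k
  have : FaithfulSMul O k := (faithfulSMul_iff_algebraMap_injective O k).2 hinj
  obtain ⟨e, he, hq, rfl⟩ := h.exists_basis (two_ne_zero_of_isUnit h2) hl hL
  intro x hx
  refine (he.mem_dualSubmodule_iff h2).2 fun i => ?_
  obtain ⟨a, ha⟩ := (e.mem_span_iff_repr_mem O x).1 hx i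
  obtain ⟨b, hb⟩ := hint _ (List.get_mem l i)
  exact ⟨b * a, by rw [map_mul, ha, hb, hq]⟩

/-- An integral lattice has an orthogonal basis. -/
theorem exists_isDiagonal_of_le_dualSubmodule [IsDiscreteValuationRing O] [FiniteDimensional k V]
    (h2 : IsUnit (2 : O)) (hq : LinearMap.BilinForm.Nondegenerate q.polarBilin) {L : Submodule O V}
    (hL : Submodule.span k (L : Set V) = ⊤)
    (hle : L ≤ LinearMap.BilinForm.dualSubmodule q.polarBilin L) :
    ∃ l : List k, (∀ a ∈ l, a ≠ 0) ∧ (∀ a ∈ l, a ∈ Set.range (algebraMap O k)) ∧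
      IsDiagonal q l L := by
  have hint : ∀ x ∈ L, ∃ a : O, algebraMap O k a = q x := by
    intro x hx
    obtain ⟨a, ha⟩ := Submodule.mem_one.1 (hle hx x hx)
    obtain ⟨b, rfl⟩ := h2.dvd (a := a)
    refine ⟨b, mul_left_cancel₀ (two_ne_zero_of_isUnit h2 : (2 : k) ≠ 0) ?_⟩
    rw [← polar_self_eq, ← polarBilin_apply_apply, ← ha, map_mul, map_ofNat]
  obtain ⟨l, hl, h⟩ := exists_isDiagonal h2 L hint fun x _ hxL => hq.1 x fun y => by
    have hy : y ∈ Submodule.span k (L : Set V) := by rw [hL]; trivial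
    exact polar_eq_zero_of_mem_span hxL hy
  refine ⟨l, hl, fun a ha => ?_, h⟩
  obtain ⟨e, -, he, hspan⟩ := h.exists_family
  obtain ⟨i, rfl⟩ := List.mem_iff_get.1 ha
  obtain ⟨b, hb⟩ := hint (e i) (hspan ▸ Submodule.subset_span ⟨i, rfl⟩)
  exact ⟨b, by rw [hb, he]⟩

/-- If `c` multiplies the dual of `L` into `L`, then it is divisible by the values of `q` on an
orthogonal basis of `L`. -/
theorem IsDiagonal.div_mem_range (h2 : IsUnit (2 : O)) {l : List k}
    (hl : ∀ a ∈ l, a ≠ 0) {L : Submodule O V} (h : IsDiagonal q l L)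
    (hL : Submodule.span k (L : Set V) = ⊤) {c : O}
    (hc : ∀ x ∈ LinearMap.BilinForm.dualSubmodule q.polarBilin L, c • x ∈ L) {a : k} (ha : a ∈ l) :
    algebraMap O k c / a ∈ Set.range (algebraMap O k) := by
  have hinj : Function.Injective (algebraMap O k) := IsFractionRing.injective O k
  have : FaithfulSMul O k := (faithfulSMul_iff_algebraMap_injective O k).2 hinj
  classical
  obtain ⟨e, he, hq, rfl⟩ := h.exists_basis (two_ne_zero_of_isUnit h2) hl hL
  obtain ⟨i, rfl⟩ := List.mem_iff_get.1 ha
  have h1 := hc ((l.get i)⁻¹ • e i) ((he.mem_dualSubmodule_iff h2).2 fun j => by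
    rw [map_smul, Module.Basis.repr_self, Finsupp.smul_apply, smul_eq_mul]
    by_cases hij : i = j
    · subst hij
      exact ⟨1, by rw [hq, Finsupp.single_eq_same, mul_one, mul_inv_cancel₀ (hl _ ha), map_one]⟩
    · exact ⟨0, by rw [Finsupp.single_eq_of_ne' hij]; simp⟩)
  have h3 := (e.mem_span_iff_repr_mem O _).1 h1 i
  rwa [← algebraMap_smul k c, map_smul, map_smul, Module.Basis.repr_self, Finsupp.smul_apply,
    Finsupp.smul_apply, Finsupp.single_eq_same, smul_eq_mul, smul_eq_mul, mul_one,
    ← div_eq_mul_inv] at h3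

/-- A self-dual lattice is unimodular: it has an orthogonal basis of vectors with unit values. -/
theorem exists_isDiagonal_units_of_dualSubmodule_eq [IsDiscreteValuationRing O]
    [FiniteDimensional k V] (h2 : IsUnit (2 : O))
    (hq : LinearMap.BilinForm.Nondegenerate q.polarBilin) {L : Submodule O V}
    (hL : Submodule.span k (L : Set V) = ⊤)
    (hdual : LinearMap.BilinForm.dualSubmodule q.polarBilin L = L) :
    ∃ us : List Oˣ, IsDiagonal q (scaledUnits 1 us) L := by
  obtain ⟨l, hl, hint, h⟩ := exists_isDiagonal_of_le_dualSubmodule h2 hq hL hdual.ge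
  have hmem : l ∈ Set.range (List.map fun u : Oˣ => (1 : k) * algebraMap O k u) := by
    rw [Set.range_list_map]
    intro a ha
    obtain ⟨b, hb⟩ := h.div_mem_range h2 hl hL (c := 1) (fun x hx => by rwa [one_smul, ← hdual]) ha
    obtain ⟨c, rfl⟩ := hint a ha
    have hbc : c * b = 1 := IsFractionRing.injective O k (by
      rw [map_mul, hb, map_one, mul_one_div_cancel (hl _ ha)])
    exact ⟨Units.mkOfMulEqOne c b hbc, by simp⟩
  obtain ⟨us, rfl⟩ := hmem
  exact ⟨us, h⟩

/-- A lattice `M` whose discriminant form is anisotropic and nonzero excludes self-dual lattices: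
a self-dual `L` would satisfy `L ∩ M^∨ ≤ M`, hence `M^∨ ≤ (L ∩ M^∨)^∨ = L + M`, hence
`M^∨ ≤ M + L ∩ M^∨ = M`. -/
theorem dualSubmodule_ne_of_anisotropic [IsDiscreteValuationRing O] [FiniteDimensional k V]
    (h2 : IsUnit (2 : O))
    (hq : LinearMap.BilinForm.Nondegenerate q.polarBilin)
    {M : Submodule O V} [Submodule.IsLattice k M]
    (hM : M ≤ LinearMap.BilinForm.dualSubmodule q.polarBilin M)
    (hne : LinearMap.BilinForm.dualSubmodule q.polarBilin M ≠ M)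
    (haniso : ∀ x ∈ LinearMap.BilinForm.dualSubmodule q.polarBilin M,
      q x ∈ Set.range (algebraMap O k) → x ∈ M)
    (L : Submodule O V) [Submodule.IsLattice k L] :
    LinearMap.BilinForm.dualSubmodule q.polarBilin L ≠ L := by
  intro hL
  have hinj : Function.Injective (algebraMap O k) := IsFractionRing.injective O k
  have : FaithfulSMul O k := (faithfulSMul_iff_algebraMap_injective O k).2 hinj
  apply hne
  refine le_antisymm (fun x hx => ?_) hM
  have hLM : ∀ y ∈ L, y ∈ LinearMap.BilinForm.dualSubmodule q.polarBilin M → y ∈ M := by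
    intro y hy hyM
    refine haniso y hyM ?_
    rw [← hL] at hy
    obtain ⟨a, ha⟩ := Submodule.mem_one.1 (hy y (hL ▸ hy))
    obtain ⟨b, rfl⟩ := h2.dvd (a := a)
    refine ⟨b, mul_left_cancel₀ (two_ne_zero_of_isUnit h2 : (2 : k) ≠ 0) ?_⟩
    rw [← polar_self_eq, ← polarBilin_apply_apply, ← ha, map_mul, map_ofNat]
  have hsymm : ∀ x y, q.polarBilin x y = q.polarBilin y x := fun x y => polar_comm q x y
  have hdd : LinearMap.BilinForm.dualSubmodule q.polarBilin
      (LinearMap.BilinForm.dualSubmodule q.polarBilin (L ⊔ M)) = L ⊔ M := by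
    let b := (Module.Free.chooseBasis O (L ⊔ M : Submodule O V))
    have hb : Submodule.span O (Set.range (b.extendOfIsLattice k)) = L ⊔ M := by
      have : ⇑(b.extendOfIsLattice k) = (L ⊔ M).subtype ∘ b := by
        ext i
        simp
      rw [this, Set.range_comp, Submodule.span_image, b.span_eq, Submodule.map_top,
        Submodule.range_subtype]
    have := LinearMap.BilinForm.dualSubmodule_dualSubmodule_of_basis (R := O)
      q.polarBilin hq ⟨hsymm⟩ (b.extendOfIsLattice k)
    rwa [hb] at this
  have hx' : x ∈ L ⊔ M := by
    rw [← hdd]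
    intro y hy
    have hyL : y ∈ L := by
      rw [← hL]
      exact fun z hz => hy z (Submodule.mem_sup_left hz)
    have hyM : y ∈ M := hLM y hyL fun z hz => hy z (Submodule.mem_sup_right hz)
    exact hx y hyM
  obtain ⟨l, hl, m, hm, rfl⟩ := Submodule.mem_sup.1 hx'
  have hl' : l ∈ LinearMap.BilinForm.dualSubmodule q.polarBilin M := by
    have := sub_mem hx (hM hm)
    rwa [add_sub_cancel_right] at this
  exact add_mem (hLM l hl hl') hm

end Dual

/-! ### Conjugacy of lattices with the same diagonalization -/

section Conjugacy

open QuadraticMap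

variable {k : Type*} [Field k] {V : Type*} [AddCommGroup V] [Module k V] {q : QuadraticForm k V}

/-- Two bases with the same diagonal Gram matrix are related by an isometry, of determinant `1`
after changing the sign of a vector if necessary. -/
theorem exists_mem_specialOrthogonalGroup (h2 : (2 : k) ≠ 0) {n : ℕ}
    {e e' : Module.Basis (Fin n) k V} (he : IsOrthogonalBasis q e) (he' : IsOrthogonalBasis q e')
    (hq : ∀ i, q (e i) = q (e' i)) (h0 : ∀ i, q (e i) ≠ 0) :
    ∃ g ∈ specialOrthogonalGroup q, ∀ i, g (e i) = e' i ∨ g (e i) = -e' i := by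
  have key : ∀ f : Module.Basis (Fin n) k V, IsOrthogonalBasis q f → (∀ i, q (e i) = q (f i)) →
      e.det f = 1 → e.equiv f (Equiv.refl _) ∈ specialOrthogonalGroup q := by
    intro f hf hqf hdet
    refine ⟨fun v => ?_, ?_⟩
    · rw [hf.apply_eq_sum h2 (e.equiv f (Equiv.refl _) v), he.apply_eq_sum h2 v]
      refine Finset.sum_congr rfl fun i _ => ?_
      rw [hqf]
      congr 2
      simp [Module.Basis.equiv]
    · rw [Units.ext_iff, LinearEquiv.coe_det, Units.val_one, ← hdet, ← mul_one (LinearMap.det _),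
        ← e.det_self, ← e.det_comp]
      congr 1
      ext i
      simp
  have hsq : e.det e' ^ 2 = 1 := by
    have := prod_eq_prod_mul_sq_of_basis h2 he' he
    simp only [hq] at this
    exact (mul_eq_left₀ (Finset.prod_ne_zero_iff.2 fun i _ => hq i ▸ h0 i)).1 this.symm
  rcases sq_eq_sq_iff_eq_or_eq_neg.1 (hsq.trans (one_pow 2).symm) with h | h
  · exact ⟨_, key e' he' hq h, fun i => Or.inl (by simp)⟩
  · obtain _ | n := n
    · exact ⟨1, one_mem _, fun i => i.elim0⟩
    · let f := e'.unitsSMul (Function.update 1 0 (-1))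
      have hf0 : f 0 = -e' 0 := by simp [f, Module.Basis.unitsSMul_apply]
      have hfs : ∀ i, i ≠ 0 → f i = e' i := fun i hi => by
        simp [f, Module.Basis.unitsSMul_apply, hi]
      have hf : ∀ i, f i = e' i ∨ f i = -e' i := fun i => by
        by_cases hi : i = 0
        · subst hi; exact Or.inr hf0
        · exact Or.inl (hfs i hi)
      have hfu : ⇑f = Function.update (⇑e') 0 (-e' 0) := by
        ext i
        by_cases hi : i = 0
        · subst hi; simp [hf0]
        · simp [hi, hfs i hi]
      refine ⟨_, key f (fun i j hij => ?_) (fun i => ?_) ?_, fun i => ?_⟩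
      · rcases hf i with h1 | h1 <;> rcases hf j with h2 | h2 <;>
          simp [h1, h2, polar_neg_left, polar_neg_right, he' i j hij]
      · rcases hf i with h1 | h1 <;> rw [h1, hq i]
        exact (QuadraticMap.map_neg q _).symm
      · rw [hfu, AlternatingMap.map_update_neg, Function.update_eq_self, h, neg_neg]
      · simpa using hf i

theorem IsDiagonal.exists_map_eq {O : Type*} [CommRing O] [Algebra O k] [Module O V]
    [IsScalarTower O k V] (h2 : (2 : k) ≠ 0) {l : List k} (hl : ∀ a ∈ l, a ≠ 0)
    {L L' : Submodule O V} (h : IsDiagonal q l L) (h' : IsDiagonal q l L')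
    (hL : Submodule.span k (L : Set V) = ⊤) (hL' : Submodule.span k (L' : Set V) = ⊤) :
    ∃ g ∈ specialOrthogonalGroup q, L.map ((g : V →ₗ[k] V).restrictScalars O) = L' := by
  obtain ⟨e, he, hq, rfl⟩ := h.exists_basis h2 hl hL
  obtain ⟨e', he', hq', rfl⟩ := h'.exists_basis h2 hl hL'
  obtain ⟨g, hg, hge⟩ := exists_mem_specialOrthogonalGroup h2 he he'
    (fun i => by rw [hq, hq']) fun i => by rw [hq]; exact hl _ (List.get_mem ..)
  refine ⟨g, hg, ?_⟩
  rw [Submodule.map_span]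
  apply le_antisymm <;> rw [Submodule.span_le]
  · rintro _ ⟨_, ⟨i, rfl⟩, rfl⟩
    have hi : e' i ∈ Submodule.span O (Set.range e') := Submodule.subset_span ⟨i, rfl⟩
    rcases hge i with h | h
    · simpa [h] using hi
    · simpa [h] using hi
  · rintro _ ⟨i, rfl⟩
    have hi := Submodule.subset_span (R := O) (Set.mem_image_of_mem
      ((g : V →ₗ[k] V).restrictScalars O) (Set.mem_range_self (f := e) i))
    rcases hge i with h | h
    · simpa [h] using hi
    · simpa [h] using hi

end Conjugacy

/-! ### Lattices with an anisotropic discriminant form -/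

section Anisotropic

open QuadraticMap IsLocalRing

variable {k : Type*} [Field k] {V : Type*} [AddCommGroup V] [Module k V] {q : QuadraticForm k V}
  {O : Type*} [CommRing O] [Algebra O k]

theorem exists_scaledUnits_perm {ϖ : k} {l : List k}
    (h : ∀ a ∈ l, ∃ u : Oˣ, a = 1 * algebraMap O k u ∨ a = ϖ * algebraMap O k u) :
    ∃ us vs : List Oˣ, l.Perm (scaledUnits 1 us ++ scaledUnits ϖ vs) := by
  induction l with
  | nil => exact ⟨[], [], List.Perm.refl _⟩
  | cons a l ih =>
    obtain ⟨us, vs, hp⟩ := ih fun b hb => h b (List.mem_cons_of_mem _ hb)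
    obtain ⟨u, rfl | rfl⟩ := h a List.mem_cons_self
    · exact ⟨u :: us, vs, hp.cons _⟩
    · exact ⟨us, u :: vs, (hp.cons _).trans List.perm_middle.symm⟩

variable [IsFractionRing O k] [Module O V] [IsScalarTower O k V]

/-- If the discriminant form of a lattice contains a hyperbolic plane, then there is an isotropic
vector in the dual lattice which does not lie in the lattice. -/
theorem IsDiagonal.exists_isotropic_notMem (h2 : IsUnit (2 : O)) {ϖ : O} (hϖ : Irreducible ϖ)
    {a b c : Oˣ} (hab : -(a * b) = c ^ 2) {l : List k} {L : Submodule O V}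
    (h : IsDiagonal q (algebraMap O k ϖ * algebraMap O k a ::
      algebraMap O k ϖ * algebraMap O k b :: l) L) :
    ∃ z ∈ LinearMap.BilinForm.dualSubmodule q.polarBilin L, q z = 0 ∧ z ∉ L := by
  obtain ⟨x, _, hx, hM, ⟨y, M, hy, hM', -, rfl⟩, rfl⟩ := h
  have hxy : polar q x y = 0 :=
    hM y (Submodule.mem_sup_left (Submodule.mem_span_singleton_self y))
  have hxM : ∀ z ∈ M, polar q x z = 0 := fun z hz => hM z (Submodule.mem_sup_right hz)
  have hϖ0 : algebraMap O k ϖ ≠ 0 := by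
    rw [map_ne_zero_iff _ (IsFractionRing.injective O k)]
    exact hϖ.ne_zero
  have hab' : -(algebraMap O k a * algebraMap O k b) = algebraMap O k c ^ 2 := by
    simpa using congrArg (fun u : Oˣ => algebraMap O k u) hab
  -- pairing of a combination of `x` and `y` with an element of the lattice
  have hpair : ∀ (s t : k) (w : V), w ∈ (O ∙ x) ⊔ ((O ∙ y) ⊔ M) → ∃ m n : O,
      polar q (s • x + t • y) w = s * (algebraMap O k ϖ * algebraMap O k (a * m)) +
        t * (algebraMap O k ϖ * algebraMap O k (b * n)) := by
    intro s t w hw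
    obtain ⟨_, hw₁, _, hw', rfl⟩ := Submodule.mem_sup.1 hw
    obtain ⟨_, hw₂, w, hwM, rfl⟩ := Submodule.mem_sup.1 hw'
    obtain ⟨m, rfl⟩ := Submodule.mem_span_singleton.1 hw₁
    obtain ⟨n, rfl⟩ := Submodule.mem_span_singleton.1 hw₂
    refine ⟨2 * m, 2 * n, ?_⟩
    simp only [polar_add_left, polar_add_right, polar_smul_left, polar_smul_right_of_tower,
      polar_self_eq, polar_comm q y x, hxy, hx, hy, hxM w hwM, hM' w hwM, Algebra.smul_def, map_mul,
      map_ofNat, Algebra.algebraMap_self, RingHom.id_apply]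
    ring
  have hmem : ∀ s t : O, (algebraMap O k s / algebraMap O k ϖ) • x +
      (algebraMap O k t / algebraMap O k ϖ) • y ∈
      LinearMap.BilinForm.dualSubmodule q.polarBilin ((O ∙ x) ⊔ ((O ∙ y) ⊔ M)) := by
    intro s t w hw
    obtain ⟨m, n, h⟩ := hpair _ _ w hw
    refine Submodule.mem_one.2 ⟨s * (a * m) + t * (b * n), ?_⟩
    rw [polarBilin_apply_apply, h]
    simp only [map_add, map_mul]
    field_simp
  refine ⟨_, hmem c a, ?_, fun hz => ?_⟩
  · have h1 := map_smul_add_smul_of_polar_eq_zero (O := k) hxy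
      (algebraMap O k c / algebraMap O k ϖ) (algebraMap O k a / algebraMap O k ϖ)
    rw [h1, hx, hy]
    simp only [Algebra.algebraMap_self, RingHom.id_apply]
    field_simp
    linear_combination -algebraMap O k a * hab'
  · -- the pairing with `ϖ⁻¹ y`, an element of the dual lattice, is not integral
    obtain ⟨r, hr⟩ := Submodule.mem_one.1 (hmem 0 1 _ hz)
    rw [polarBilin_apply_apply, map_zero, zero_div, zero_smul, zero_add, map_one,
      polar_smul_left, polar_add_right, polar_smul_right, polar_smul_right, polar_comm q y x, hxy,
      polar_self_eq, hy] at hr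
    have h3 : ϖ * r = 2 * a * b := by
      apply IsFractionRing.injective O k
      rw [map_mul, hr]
      simp only [map_mul, map_ofNat, smul_eq_mul]
      field_simp
      ring
    exact hϖ.not_isUnit (isUnit_of_dvd_unit ⟨r, h3.symm⟩ ((h2.mul a.isUnit).mul b.isUnit))

variable [IsDomain O] [IsDiscreteValuationRing O]

/-- A lattice with anisotropic nonzero discriminant form, in a space whose determinant is a unit, is
the sum of a unimodular lattice and `ϖ ⟨1, -δ⟩` for a non-square unit `δ`: over a finite field,
an anisotropic form has rank at most `2`. -/
theorem exists_isDiagonal_of_anisotropic [HenselianLocalRing O] [Finite (ResidueField O)]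
    [FiniteDimensional k V] (hk : ringChar (ResidueField O) ≠ 2)
    (hq : LinearMap.BilinForm.Nondegenerate q.polarBilin)
    (hd : ∀ l : List k, (∀ a ∈ l, a ≠ 0) → IsDiagonal q l (⊤ : Submodule k V) →
      ∃ (u : Oˣ) (c : k), c ≠ 0 ∧ l.prod = algebraMap O k u * c ^ 2)
    {ϖ : O} (hϖ : Irreducible ϖ) {L : Submodule O V} (hL : Submodule.span k (L : Set V) = ⊤)
    (hle : L ≤ LinearMap.BilinForm.dualSubmodule q.polarBilin L)
    (hϖL : ∀ x ∈ LinearMap.BilinForm.dualSubmodule q.polarBilin L, ϖ • x ∈ L)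
    (haniso : ∀ x ∈ LinearMap.BilinForm.dualSubmodule q.polarBilin L,
      q x ∈ Set.range (algebraMap O k) → x ∈ L)
    (hne : LinearMap.BilinForm.dualSubmodule q.polarBilin L ≠ L) :
    ∃ (us : List Oˣ) (δ : Oˣ), unitsQuadraticChar O δ = -1 ∧
      IsDiagonal q (scaledUnits 1 us ++ scaledUnits (algebraMap O k ϖ) [1, -δ]) L := by
  have h2 := isUnit_two_of_ringChar_residueField_ne_two hk
  obtain ⟨l, hl, hint, h⟩ := exists_isDiagonal_of_le_dualSubmodule h2 hq hL hle
  obtain ⟨us, vs, hp⟩ := exists_scaledUnits_perm (O := O) (ϖ := algebraMap O k ϖ) (l := l) (by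
    intro a ha
    obtain ⟨b, hb⟩ := h.div_mem_range h2 hl hL hϖL ha
    obtain ⟨a, rfl⟩ := hint a ha
    have hab : ϖ = a * b := IsFractionRing.injective O k (by
      rw [map_mul, hb, mul_div_cancel₀ _ (hl _ ha)])
    rcases hϖ.isUnit_or_isUnit hab with ⟨u, rfl⟩ | ⟨u, rfl⟩
    · exact ⟨u, Or.inl (one_mul _).symm⟩
    · refine ⟨u⁻¹, Or.inr ?_⟩
      rw [← map_mul, hab, mul_assoc, Units.mul_inv, mul_one])
  replace h := h.perm hp
  have hl' : ∀ a ∈ scaledUnits 1 us ++ scaledUnits (algebraMap O k ϖ) vs, a ≠ 0 :=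
    fun a ha => hl a (hp.mem_iff.2 ha)
  obtain ⟨u, c, hc, hprod⟩ := hd _ hl' (hL ▸ h.span)
  have heven : Even vs.length := by
    rw [List.prod_append, prod_scaledUnits, prod_scaledUnits, one_pow, mul_one, ← mul_assoc,
      ← map_mul, ← Units.val_mul] at hprod
    exact even_of_unit_mul_pow_mul_sq_eq (c := (1 : k)) (d := c) hϖ one_ne_zero
      (by rw [one_pow, mul_one]; exact hprod)
  have hiso : ∀ {a b c : Oˣ} {ws : List Oˣ}, -(a * b) = c ^ (2 : ℕ) →
      ¬ IsDiagonal q (scaledUnits 1 us ++ scaledUnits (algebraMap O k ϖ) (a :: b :: ws)) L := by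
    intro a b c ws hab h
    obtain ⟨z, hz, hqz, hzL⟩ := IsDiagonal.exists_isotropic_notMem h2 hϖ hab
      (h.perm List.perm_append_comm)
    exact hzL (haniso z hz ⟨0, by rw [hqz, map_zero]⟩)
  have hchange : ∀ ws : List Oˣ, vs.length = ws.length → (∃ c : Oˣ, vs.prod = ws.prod * c ^ 2) →
      IsDiagonal q (scaledUnits 1 us ++ scaledUnits (algebraMap O k ϖ) ws) L := by
    intro ws hlen hws
    obtain ⟨L₁, L₂, h₁, h₂, h₁₂, rfl⟩ := isDiagonal_append.1 h
    exact isDiagonal_append.2 ⟨L₁, L₂, h₁, h₂.change_units hk _ hlen hws, h₁₂, rfl⟩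
  match vs, heven, h, hchange with
  | [], _, h, _ =>
    refine (hne (IsDiagonal.dualSubmodule_eq h2 (us := us) ?_ hL)).elim
    simpa using h
  | [a], hev, _, _ => simp at hev
  | [a, b], _, h, hchange =>
    refine ⟨us, -(a * b), ?_, hchange _ rfl ⟨1, by simp⟩⟩
    rcases Int.units_eq_one_or (unitsQuadraticChar O (-(a * b))) with h1 | h1
    · obtain ⟨c, hc⟩ := (unitsQuadraticChar_eq_one_iff hk).1 h1
      exact (hiso hc h).elim
    · exact h1
  | a :: b :: c :: ws, _, _, hchange =>
    exact (hiso (c := 1) (by simp) (hchange (1 :: -1 :: -(a * b * c) :: ws) rfl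
      ⟨1, by simp [mul_assoc]⟩)).elim

/-- Coordinates on the dual of the lattice `⟨units⟩ ⊥ ϖ ⟨1, -δ⟩`, in terms of which the
discriminant form is `α² - δ β²`. -/
theorem IsOrthogonalBasis.exists_dual_coordinates (h2 : IsUnit (2 : O)) {ϖ : O}
    (hϖ : Irreducible ϖ) {δ : Oˣ} {n : ℕ} {e : Module.Basis (Fin (n + 2)) k V}
    (he : IsOrthogonalBasis q e) (h0 : q (e 0) = algebraMap O k ϖ)
    (h1 : q (e 1) = -(algebraMap O k ϖ * algebraMap O k δ))
    (hu : ∀ i : Fin n, ∃ u : Oˣ, q (e i.succ.succ) = algebraMap O k u) {L : Submodule O V}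
    (hL : Submodule.span O (Set.range e) = L) :
    ∃ α β : LinearMap.BilinForm.dualSubmodule q.polarBilin L →ₗ[O] O,
      (∀ x, ∃ t : O, algebraMap O k (ϖ * t + (α x ^ 2 - δ * β x ^ 2)) = algebraMap O k ϖ * q x) ∧
      (∀ x : LinearMap.BilinForm.dualSubmodule q.polarBilin L,
        (x : V) ∈ L ↔ ϖ ∣ α x ∧ ϖ ∣ β x) ∧
      ∀ a b : O, ∃ x, α x = a ∧ β x = b := by
  subst hL
  have hinj : Function.Injective (algebraMap O k) := IsFractionRing.injective O k
  have : FaithfulSMul O k := (faithfulSMul_iff_algebraMap_injective O k).2 hinj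
  have hϖ0 : algebraMap O k ϖ ≠ 0 := by
    rw [map_ne_zero_iff _ hinj]
    exact hϖ.ne_zero
  set D := LinearMap.BilinForm.dualSubmodule q.polarBilin (Submodule.span O (Set.range e)) with hD
  have hδ : algebraMap O k (↑δ⁻¹ : O) * algebraMap O k δ = 1 := by rw [← map_mul]; simp
  have hdual : ∀ x : V, x ∈ D ↔
      algebraMap O k ϖ * e.repr x 0 ∈ Set.range (algebraMap O k) ∧
      algebraMap O k ϖ * e.repr x 1 ∈ Set.range (algebraMap O k) ∧
      ∀ i : Fin n, e.repr x i.succ.succ ∈ Set.range (algebraMap O k) := by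
    intro x
    rw [hD, he.mem_dualSubmodule_iff h2, Fin.forall_fin_succ, Fin.forall_fin_succ, h0,
      show (Fin.succ 0 : Fin (n + 2)) = 1 from rfl, h1]
    refine and_congr Iff.rfl (and_congr ⟨?_, ?_⟩ (forall_congr' fun i => ?_))
    · rintro ⟨a, ha⟩
      refine ⟨-↑δ⁻¹ * a, ?_⟩
      rw [map_mul, ha, map_neg]
      linear_combination (algebraMap O k ϖ * e.repr x 1) * hδ
    · rintro ⟨a, ha⟩
      refine ⟨-δ * a, ?_⟩
      rw [map_mul, ha, map_neg]
      ring
    · obtain ⟨u, hu⟩ := hu i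
      have hu' : algebraMap O k (↑u⁻¹ : O) * algebraMap O k u = 1 := by rw [← map_mul]; simp
      rw [hu]
      constructor
      · rintro ⟨a, ha⟩
        refine ⟨↑u⁻¹ * a, ?_⟩
        rw [map_mul, ha, ← mul_assoc, hu', one_mul]
      · rintro ⟨a, ha⟩
        exact ⟨u * a, by rw [map_mul, ha]⟩
  have hlift : ∀ F : D →ₗ[O] k, (∀ x, F x ∈ Set.range (algebraMap O k)) →
      ∃ G : D →ₗ[O] O, ∀ x, algebraMap O k (G x) = F x := by
    intro F hF
    choose g hg using hF
    exact ⟨{ toFun := g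
             map_add' := fun x y => hinj (by rw [map_add, hg, hg, hg, map_add])
             map_smul' := fun c x => hinj (by
               rw [RingHom.id_apply, smul_eq_mul, map_mul, hg, hg, map_smul,
                 Algebra.smul_def]) }, hg⟩
  obtain ⟨α, hα⟩ := hlift (((algebraMap O k ϖ • e.coord 0).restrictScalars O).comp D.subtype)
    fun x => ((hdual x).1 x.2).1
  obtain ⟨β, hβ⟩ := hlift (((algebraMap O k ϖ • e.coord 1).restrictScalars O).comp D.subtype)
    fun x => ((hdual x).1 x.2).2.1
  replace hα : ∀ x : D, algebraMap O k (α x) = algebraMap O k ϖ * e.repr x 0 := hα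
  replace hβ : ∀ x : D, algebraMap O k (β x) = algebraMap O k ϖ * e.repr x 1 := hβ
  refine ⟨α, β, fun x => ?_, fun x => ?_, fun a b => ?_⟩
  · choose u hu using hu
    choose c hc using ((hdual x).1 x.2).2.2
    refine ⟨∑ i, u i * c i ^ 2, ?_⟩
    rw [he.apply_eq_sum (two_ne_zero_of_isUnit h2), Fin.sum_univ_succ, Fin.sum_univ_succ, h0,
      show (Fin.succ 0 : Fin (n + 2)) = 1 from rfl, h1]
    simp only [map_add, map_sub, map_mul, map_pow, map_sum, hα, hβ, hu, hc]
    ring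
  · have hdvd : ∀ (a : O) (r : k), algebraMap O k a = algebraMap O k ϖ * r →
        (r ∈ Set.range (algebraMap O k) ↔ ϖ ∣ a) := by
      intro a r ha
      constructor
      · rintro ⟨b, rfl⟩
        exact ⟨b, hinj (by rw [ha, map_mul])⟩
      · rintro ⟨b, rfl⟩
        exact ⟨b, mul_left_cancel₀ hϖ0 (by rw [← ha, map_mul])⟩
    rw [e.mem_span_iff_repr_mem O, Fin.forall_fin_succ, Fin.forall_fin_succ,
      show (Fin.succ 0 : Fin (n + 2)) = 1 from rfl, hdvd _ _ (hα x), hdvd _ _ (hβ x)]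
    exact ⟨fun h => ⟨h.1, h.2.1⟩, fun h => ⟨h.1, h.2, ((hdual x).1 x.2).2.2⟩⟩
  · have hx : (algebraMap O k a / algebraMap O k ϖ) • e 0 +
        (algebraMap O k b / algebraMap O k ϖ) • e 1 ∈ D := by
      refine (hdual _).2 ⟨⟨a, ?_⟩, ⟨b, ?_⟩, fun i => ⟨0, ?_⟩⟩
      · simp [mul_div_cancel₀ _ hϖ0]
      · simp [mul_div_cancel₀ _ hϖ0]
      · simp [Fin.ext_iff]
    refine ⟨⟨_, hx⟩, hinj ?_, hinj ?_⟩
    · rw [hα]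
      simp [mul_div_cancel₀ _ hϖ0]
    · rw [hβ]
      simp [mul_div_cancel₀ _ hϖ0]

theorem IsDiagonal.exists_dual_coordinates (h2 : IsUnit (2 : O)) {ϖ : O}
    (hϖ : Irreducible ϖ) {us : List Oˣ} {δ : Oˣ} {L : Submodule O V}
    (h : IsDiagonal q (scaledUnits 1 us ++ scaledUnits (algebraMap O k ϖ) [1, -δ]) L)
    (hL : Submodule.span k (L : Set V) = ⊤) :
    ∃ α β : LinearMap.BilinForm.dualSubmodule q.polarBilin L →ₗ[O] O,
      (∀ x, ∃ t : O, algebraMap O k (ϖ * t + (α x ^ 2 - δ * β x ^ 2)) = algebraMap O k ϖ * q x) ∧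
      (∀ x : LinearMap.BilinForm.dualSubmodule q.polarBilin L,
        (x : V) ∈ L ↔ ϖ ∣ α x ∧ ϖ ∣ β x) ∧
      ∀ a b : O, ∃ x, α x = a ∧ β x = b := by
  have hϖ0 : algebraMap O k ϖ ≠ 0 := by
    rw [map_ne_zero_iff _ (IsFractionRing.injective O k)]
    exact hϖ.ne_zero
  have hl : ∀ a ∈ scaledUnits (algebraMap O k ϖ) [1, -δ] ++ scaledUnits 1 us, a ≠ 0 := by
    intro a ha
    rcases List.mem_append.1 ha with ha | ha
    · exact scaledUnits_ne_zero hϖ0 _ a ha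
    · exact scaledUnits_ne_zero one_ne_zero _ a ha
  obtain ⟨e, he, hq, hspan⟩ := (h.perm List.perm_append_comm).exists_basis
    (two_ne_zero_of_isUnit h2) hl hL
  refine IsOrthogonalBasis.exists_dual_coordinates (n := (scaledUnits (1 : k) us).length) (e := e)
    h2 hϖ he ?_ ?_ (fun i => ?_) hspan
  · refine (hq _).trans ?_
    change algebraMap O k ϖ * algebraMap O k (1 : Oˣ) = _
    simp
  · refine (hq _).trans ?_
    change algebraMap O k ϖ * algebraMap O k (-δ : Oˣ) = _
    simp
  · obtain ⟨u, -, hu⟩ := List.mem_map.1 (List.get_mem (scaledUnits (1 : k) us) i)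
    refine ⟨u, (hq _).trans ?_⟩
    change (scaledUnits (1 : k) us).get i = _
    rw [← hu, one_mul]

end Anisotropic

/-! ### Norm forms of quadratic extensions of finite fields -/

section NormForm

variable {F ℓ : Type*} [Field F] [Field ℓ] [Algebra F ℓ]

/-- The quadratic extension of a finite field `F` of odd characteristic contains a square root of
every element of `F`. -/
theorem exists_sq_eq_algebraMap_of_finrank_eq_two [Finite F] (hF : ringChar F ≠ 2)
    (h : Module.finrank F ℓ = 2) (a : F) : ∃ θ : ℓ, θ ^ 2 = algebraMap F ℓ a := by
  by_cases ha : a = 0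
  · exact ⟨0, by simp [ha]⟩
  have : FiniteDimensional F ℓ := FiniteDimensional.of_finrank_eq_succ h
  have : Finite ℓ := Module.finite_of_finite F
  let := Fintype.ofFinite F
  let := Fintype.ofFinite ℓ
  have hℓ : ringChar ℓ ≠ 2 := by
    rwa [← Algebra.ringChar_eq F ℓ]
  obtain ⟨m, hm⟩ := Nat.odd_iff.2 (FiniteField.odd_card_of_char_ne_two hF)
  have hcard : Fintype.card ℓ / 2 = (Fintype.card F - 1) * (m + 1) := by
    have h1 := Module.card_eq_pow_finrank (K := F) (V := ℓ)
    rw [h, hm] at h1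
    rw [h1, hm]
    have : (2 * m + 1) ^ 2 = 2 * ((2 * m) * (m + 1)) + 1 := by ring
    rw [this]
    simp only [Nat.add_sub_cancel]
    omega
  obtain ⟨θ, hθ⟩ := (FiniteField.isSquare_iff hℓ (a := algebraMap F ℓ a) (by simpa using ha)).2 (by
    rw [hcard, ← map_pow, pow_mul, FiniteField.pow_card_sub_one_eq_one a ha, one_pow, map_one])
  exact ⟨θ, by rw [hθ, sq]⟩

/-- A quadratic extension generated by a square root `θ` of a non-square `δ` has basis `1, θ` and
norm form `x² - δ y²`. -/
theorem exists_basis_and_norm_eq {δ : F} (hδ : ¬ IsSquare δ) {θ : ℓ}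
    (h : Module.finrank F ℓ = 2) (hθ : θ ^ 2 = algebraMap F ℓ δ) :
    (∀ x y : F, algebraMap F ℓ x + algebraMap F ℓ y * θ = 0 → x = 0 ∧ y = 0) ∧
    (∀ z : ℓ, ∃ x y : F, z = algebraMap F ℓ x + algebraMap F ℓ y * θ) ∧
    ∀ x y : F, Algebra.norm F (algebraMap F ℓ x + algebraMap F ℓ y * θ) = x ^ 2 - δ * y ^ 2 := by
  have hinj : Function.Injective (algebraMap F ℓ) := (algebraMap F ℓ).injective
  have h0 : ∀ x y : F, algebraMap F ℓ x + algebraMap F ℓ y * θ = 0 → x = 0 ∧ y = 0 := by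
    intro x y hxy
    have hy : y = 0 := by
      by_contra hy
      refine hδ ⟨x / y, hinj ?_⟩
      have hy' : algebraMap F ℓ y ≠ 0 := by simpa using hy
      rw [← hθ, map_mul, map_div₀]
      field_simp
      linear_combination (algebraMap F ℓ y * θ - algebraMap F ℓ x) * hxy
    subst hy
    simpa using hxy
  have hli : LinearIndependent F ![1, θ] := by
    rw [LinearIndependent.pair_iff]
    intro x y hxy
    exact h0 x y (by simpa [Algebra.smul_def] using hxy)
  let b := basisOfLinearIndependentOfCardEqFinrank hli (by simp [h])
  have hb0 : b 0 = 1 := by simp [b]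
  have hb1 : b 1 = θ := by simp [b]
  have hrepr : ∀ x y : F, b.repr (algebraMap F ℓ x + algebraMap F ℓ y * θ) =
      Finsupp.single 0 x + Finsupp.single 1 y := by
    intro x y
    have : algebraMap F ℓ x + algebraMap F ℓ y * θ = x • b 0 + y • b 1 := by
      rw [hb0, hb1, Algebra.smul_def, Algebra.smul_def, mul_one]
    rw [this, map_add, map_smul, map_smul, b.repr_self, b.repr_self]
    simp
  refine ⟨h0, fun z => ⟨b.repr z 0, b.repr z 1, ?_⟩, fun x y => ?_⟩
  · conv_lhs => rw [← b.sum_repr z]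
    rw [Fin.sum_univ_two, hb0, hb1, Algebra.smul_def, Algebra.smul_def, mul_one]
  · have h1 : (algebraMap F ℓ x + algebraMap F ℓ y * θ) * θ =
        algebraMap F ℓ (δ * y) + algebraMap F ℓ x * θ := by
      rw [map_mul]
      linear_combination algebraMap F ℓ y * hθ
    rw [Algebra.norm_eq_matrix_det b, Matrix.det_fin_two]
    simp only [Algebra.leftMulMatrix_eq_repr_mul, hb0, hb1, mul_one, h1, hrepr, Finsupp.add_apply]
    simp
    ring

end NormForm

/-! ### The lattice with the norm form as discriminant form -/

section NormLattice

open QuadraticMap IsLocalRing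

variable {k : Type*} [Field k] {V : Type*} [AddCommGroup V] [Module k V] {q : QuadraticForm k V}

theorem henselianLocalRing_integer (k : Type*) [Field k] [ValuativeRel k] [TopologicalSpace k]
    [IsNonarchimedeanLocalField k] : HenselianLocalRing 𝒪[k] := by
  let := IsTopologicalAddGroup.rightUniformSpace k
  have := isUniformAddGroup_of_addCommGroup (G := k)
  have : IsAdicComplete (maximalIdeal 𝒪[k]) 𝒪[k] := inferInstanceAs (IsAdicComplete 𝓂[k] 𝒪[k])
  have h : HenselianRing 𝒪[k] (maximalIdeal 𝒪[k]) := inferInstance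
  exact { is_henselian := fun f hf a ha hu => h.is_henselian f hf a ha (hu.map _) }

/-- The values at an orthogonal basis of a nondegenerate space do not vanish. -/
theorem IsOrthogonalBasis.apply_ne_zero (hq : LinearMap.BilinForm.Nondegenerate q.polarBilin)
    {ι : Type*} {e : Module.Basis ι k V} (he : IsOrthogonalBasis q e) (i : ι) : q (e i) ≠ 0 := by
  intro h
  refine e.ne_zero i (hq.1 _ fun x => ?_)
  rw [polarBilin_apply_apply, polar_comm, he.polar_eq, h, mul_zero, zero_mul]

theorem IsOrthogonalBasis.isDiagonal_top {n : ℕ} {e : Module.Basis (Fin n) k V}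
    (he : IsOrthogonalBasis q e) :
    IsDiagonal q (List.ofFn fun i => q (e i)) (⊤ : Submodule k V) := by
  rw [← e.span_eq]
  exact isDiagonal_ofFn e he

variable {O : Type*} [CommRing O] [IsDomain O] [IsDiscreteValuationRing O] [HenselianLocalRing O]
  [Finite (ResidueField O)] [Algebra O k] [IsFractionRing O k] [Module O V] [IsScalarTower O k V]

/-- The lattice `⟨units⟩ ⊥ ϖ ⟨1, -δ⟩` with `δ` a non-square unit has an anisotropic discriminant
form. -/
theorem IsDiagonal.anisotropic (hk : ringChar (ResidueField O) ≠ 2) {ϖ : O}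
    (hϖ : Irreducible ϖ) {us : List Oˣ} {δ : Oˣ} (hδ : unitsQuadraticChar O δ = -1)
    {L : Submodule O V}
    (h : IsDiagonal q (scaledUnits 1 us ++ scaledUnits (algebraMap O k ϖ) [1, -δ]) L)
    (hL : Submodule.span k (L : Set V) = ⊤) :
    (∀ x ∈ LinearMap.BilinForm.dualSubmodule q.polarBilin L,
      q x ∈ Set.range (algebraMap O k) → x ∈ L) ∧
    LinearMap.BilinForm.dualSubmodule q.polarBilin L ≠ L := by
  obtain ⟨α, β, hq, hmem, hsurj⟩ :=
    h.exists_dual_coordinates (isUnit_two_of_ringChar_residueField_ne_two hk) hϖ hL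
  have hr : ∀ w : O, residue O w = 0 ↔ ϖ ∣ w := fun w => by
    rw [residue_eq_zero_iff, hϖ.maximalIdeal_eq, Ideal.mem_span_singleton]
  constructor
  · rintro x hx ⟨a, ha⟩
    obtain ⟨t, ht⟩ := hq ⟨x, hx⟩
    rw [← ha, ← map_mul] at ht
    have h1 := congrArg (residue O) (IsFractionRing.injective O k ht)
    simp only [map_add, map_sub, map_mul, map_pow, (hr ϖ).2 dvd_rfl, zero_mul, zero_add] at h1
    have hβ : residue O (β ⟨x, hx⟩) = 0 := by
      by_contra hβ
      refine unitsQuadraticChar_eq_neg_one_iff.1 hδ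
        ⟨residue O (α ⟨x, hx⟩) / residue O (β ⟨x, hx⟩), ?_⟩
      field_simp
      linear_combination -h1
    have hα : residue O (α ⟨x, hx⟩) = 0 := by simpa [hβ] using h1
    exact (hmem ⟨x, hx⟩).2 ⟨(hr _).1 hα, (hr _).1 hβ⟩
  · intro hdual
    obtain ⟨x, hα, -⟩ := hsurj 1 0
    have h1 := ((hmem x).1 (hdual.le x.2)).1
    rw [hα] at h1
    exact hϖ.not_isUnit (isUnit_of_dvd_one h1)

/-- The discriminant form of the lattice `⟨units⟩ ⊥ ϖ ⟨1, -δ⟩`, with `δ` a non-square unit, is the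
norm form of the quadratic extension of the residue field. -/
theorem IsDiagonal.exists_norm_isometry (hk : ringChar (ResidueField O) ≠ 2) {ϖ : O}
    (hϖ : Irreducible ϖ) {us : List Oˣ} {δ : Oˣ} (hδ : unitsQuadraticChar O δ = -1)
    {L : Submodule O V}
    (h : IsDiagonal q (scaledUnits 1 us ++ scaledUnits (algebraMap O k ϖ) [1, -δ]) L)
    (hL : Submodule.span k (L : Set V) = ⊤) (ℓ : Type*) [Field ℓ] [Algebra (ResidueField O) ℓ]
    (hℓ : Module.finrank (ResidueField O) ℓ = 2) :
    ∃ φ : (LinearMap.BilinForm.dualSubmodule q.polarBilin L ⧸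
        L.submoduleOf (LinearMap.BilinForm.dualSubmodule q.polarBilin L)) ≃+ ℓ,
      (∀ (a : O) x, φ (a • x) = residue O a • φ x) ∧
      ∀ x : LinearMap.BilinForm.dualSubmodule q.polarBilin L, ∃ b : O,
        algebraMap O k b = algebraMap O k ϖ * q (x : V) ∧
        residue O b = Algebra.norm (ResidueField O) (φ (Submodule.Quotient.mk x)) := by
  obtain ⟨α, β, hq, hmem, hsurj⟩ :=
    h.exists_dual_coordinates (isUnit_two_of_ringChar_residueField_ne_two hk) hϖ hL
  have hr : ∀ w : O, residue O w = 0 ↔ ϖ ∣ w := fun w => by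
    rw [residue_eq_zero_iff, hϖ.maximalIdeal_eq, Ideal.mem_span_singleton]
  obtain ⟨θ, hθ⟩ := exists_sq_eq_algebraMap_of_finrank_eq_two hk hℓ (residue O δ)
  obtain ⟨h0, hspan, hnorm⟩ :=
    exists_basis_and_norm_eq (unitsQuadraticChar_eq_neg_one_iff.1 hδ) hℓ hθ
  let : Module O ℓ := Module.compHom ℓ (residue O)
  have hsmul : ∀ (a : O) (z : ℓ), a • z = algebraMap (ResidueField O) ℓ (residue O a) * z :=
    fun a z => Algebra.smul_def (residue O a) z
  let ψ : LinearMap.BilinForm.dualSubmodule q.polarBilin L →ₗ[O] ℓ :=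
    { toFun := fun x => algebraMap (ResidueField O) ℓ (residue O (α x)) +
        algebraMap (ResidueField O) ℓ (residue O (β x)) * θ
      map_add' := fun x y => by simp only [map_add]; ring
      map_smul' := fun a x => by
        simp only [map_smul, smul_eq_mul, map_mul, RingHom.id_apply, hsmul]
        ring }
  have hψ : ∀ x, ψ x = algebraMap (ResidueField O) ℓ (residue O (α x)) +
        algebraMap (ResidueField O) ℓ (residue O (β x)) * θ := fun x => rfl
  have hker : L.submoduleOf (LinearMap.BilinForm.dualSubmodule q.polarBilin L) =
      LinearMap.ker ψ := by
    ext x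
    rw [Submodule.submoduleOf, Submodule.mem_comap, Submodule.subtype_apply, hmem,
      LinearMap.mem_ker, hψ, ← hr, ← hr]
    exact ⟨fun h => by simp [h.1, h.2], fun h => h0 _ _ h⟩
  have hsurjψ : Function.Surjective ψ := by
    intro z
    obtain ⟨a, b, rfl⟩ := hspan z
    obtain ⟨a, rfl⟩ := residue_surjective a
    obtain ⟨b, rfl⟩ := residue_surjective b
    obtain ⟨x, rfl, rfl⟩ := hsurj a b
    exact ⟨x, rfl⟩
  let φ := (Submodule.quotEquivOfEq _ _ hker).trans (ψ.quotKerEquivOfSurjective hsurjψ)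
  refine ⟨φ.toAddEquiv, fun a x => map_smul φ a x, fun x => ?_⟩
  obtain ⟨t, ht⟩ := hq x
  refine ⟨_, ht, ?_⟩
  have hφ : φ (Submodule.Quotient.mk x) = ψ x := rfl
  change _ = Algebra.norm (ResidueField O) (φ (Submodule.Quotient.mk x))
  rw [hφ, hψ, hnorm]
  simp only [map_add, map_sub, map_mul, map_pow, (hr ϖ).2 dvd_rfl, zero_mul, zero_add]

end NormLattice

/-! ### Self-dual lattices and norm lattices over a local field -/

section LocalField

open QuadraticMap IsLocalRing

variable {k : Type*} [Field k] {V : Type*} [AddCommGroup V] [Module k V] {q : QuadraticForm k V}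

/-- If the determinant of the space is a unit modulo squares, so is the product of the values in
every diagonalization. -/
theorem HasDeterminant.exists_prod_eq {O : Type*} [CommRing O] [Algebra O k] (h2 : (2 : k) ≠ 0)
    (hq : LinearMap.BilinForm.Nondegenerate q.polarBilin) {u : Oˣ}
    (hd : HasDeterminant q (algebraMap O k u)) {l : List k} (hl : ∀ a ∈ l, a ≠ 0)
    (h : IsDiagonal q l (⊤ : Submodule k V)) :
    ∃ (u : Oˣ) (c : k), c ≠ 0 ∧ l.prod = algebraMap O k u * c ^ 2 := by
  obtain ⟨e, he, c, hc, hprod⟩ := hd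
  obtain ⟨d, hd, h1⟩ := h.exists_prod_eq_prod_mul_sq h2 hl
    (List.forall_mem_ofFn_iff.2 fun i => he.apply_ne_zero hq i) he.isDiagonal_top
    Submodule.span_univ Submodule.span_univ
  exact ⟨u, c * d, mul_ne_zero hc hd, by rw [h1, List.prod_ofFn, hprod]; ring⟩

variable [ValuativeRel k]

theorem IsNormLattice.smul_mem {ϖ : 𝒪[k]} (hϖ : Irreducible ϖ) {ℓ : Type*} [Field ℓ]
    [Algebra 𝓀[k] ℓ] {L : Submodule 𝒪[k] V} (h : IsNormLattice q ϖ ℓ L) :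
    ∀ x ∈ dual q L, ϖ • x ∈ L := by
  intro x hx
  obtain ⟨φ, hφ, -⟩ := h.isometric
  have h0 : residue 𝒪[k] ϖ = 0 := (residue_eq_zero_iff _).2 hϖ.not_isUnit
  have h1 := hφ ϖ (Submodule.Quotient.mk ⟨x, hx⟩)
  rw [h0, zero_smul, map_eq_zero_iff φ φ.injective, ← Submodule.Quotient.mk_smul,
    Submodule.Quotient.mk_eq_zero] at h1
  exact h1

/-- The discriminant form of such a lattice is anisotropic, as the norm of a field extension
vanishes only at `0`. -/
theorem IsNormLattice.mem_of_apply_mem_range {ϖ : 𝒪[k]} (hϖ : Irreducible ϖ) {ℓ : Type*} [Field ℓ]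
    [Algebra 𝓀[k] ℓ] (hℓ : Module.finrank 𝓀[k] ℓ = 2) {L : Submodule 𝒪[k] V}
    (h : IsNormLattice q ϖ ℓ L) :
    ∀ x ∈ dual q L, q x ∈ Set.range (algebraMap 𝒪[k] k) → x ∈ L := by
  rintro x hx ⟨a, ha⟩
  have : FiniteDimensional 𝓀[k] ℓ := FiniteDimensional.of_finrank_eq_succ hℓ
  obtain ⟨φ, -, hφ⟩ := h.isometric
  have h0 : residue 𝒪[k] ϖ = 0 := (residue_eq_zero_iff _).2 hϖ.not_isUnit
  obtain ⟨b, hb, hN⟩ := hφ ⟨x, hx⟩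
  have hb' : b = ϖ * a := Subtype.ext (by rw [hb, ← ha]; rfl)
  rw [hb', map_mul, h0, zero_mul, eq_comm, Algebra.norm_eq_zero_iff, map_eq_zero_iff φ φ.injective,
    Submodule.Quotient.mk_eq_zero] at hN
  exact hN

theorem IsNormLattice.dual_ne {ϖ : 𝒪[k]} {ℓ : Type*} [Field ℓ] [Algebra 𝓀[k] ℓ]
    {L : Submodule 𝒪[k] V} (h : IsNormLattice q ϖ ℓ L) : dual q L ≠ L := by
  intro hdual
  obtain ⟨φ, -, -⟩ := h.isometric
  obtain ⟨x, hx⟩ := φ.surjective 1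
  obtain ⟨x, rfl⟩ := Submodule.Quotient.mk_surjective _ x
  have : (Submodule.Quotient.mk x : DiscriminantModule q L) = 0 :=
    (Submodule.Quotient.mk_eq_zero _).2 (hdual.le x.2)
  rw [this, map_zero] at hx
  exact zero_ne_one hx

theorem IsDiagonal.areConjugate {l : List k} (h2 : (2 : k) ≠ 0) (hl : ∀ a ∈ l, a ≠ 0)
    {L L' : Submodule 𝒪[k] V} (h : IsDiagonal q l L) (h' : IsDiagonal q l L')
    (hL : Submodule.span k (L : Set V) = ⊤) (hL' : Submodule.span k (L' : Set V) = ⊤) :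
    AreConjugate q L L' :=
  h.exists_map_eq h2 hl h' hL hL'

end LocalField

end OrthogonalLattice

open OrthogonalLattice in
theorem theorem6p1
    {k : Type*} [Field k] [ValuativeRel k] [TopologicalSpace k] [IsNonarchimedeanLocalField k]
    (hk : ringChar 𝓀[k] ≠ 2)
    {V : Type*} [AddCommGroup V] [Module k V] [FiniteDimensional k V]
    (q : QuadraticForm k V) (hq : LinearMap.BilinForm.Nondegenerate q.polarBilin)
    (hd : ∃ u : 𝒪[k]ˣ, OrthogonalLattice.HasDeterminant q ((u : 𝒪[k]) : k)) :
    (OrthogonalLattice.HasHasseWittInvariant q 1 →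
      (∃ L : Submodule 𝒪[k] V, OrthogonalLattice.IsSelfDualLattice q L) ∧
      (∀ L L' : Submodule 𝒪[k] V, OrthogonalLattice.IsSelfDualLattice q L →
        OrthogonalLattice.IsSelfDualLattice q L' → OrthogonalLattice.AreConjugate q L L')) ∧
    (OrthogonalLattice.HasHasseWittInvariant q (-1) →
      (¬ ∃ L : Submodule 𝒪[k] V, OrthogonalLattice.IsSelfDualLattice q L) ∧
      (∀ ϖ : 𝒪[k], Irreducible ϖ →
        ∀ (ℓ : Type*) [Field ℓ] [Algebra 𝓀[k] ℓ], Module.finrank 𝓀[k] ℓ = 2 →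
        (∃ L : Submodule 𝒪[k] V, OrthogonalLattice.IsNormLattice q ϖ ℓ L) ∧
        (∀ L L' : Submodule 𝒪[k] V, OrthogonalLattice.IsNormLattice q ϖ ℓ L →
          OrthogonalLattice.IsNormLattice q ϖ ℓ L' → OrthogonalLattice.AreConjugate q L L'))) := by
  have := henselianLocalRing_integer k
  have h2 := isUnit_two_of_ringChar_residueField_ne_two hk
  have h2k : (2 : k) ≠ 0 := two_ne_zero_of_isUnit h2
  have hinj : Function.Injective (algebraMap 𝒪[k] k) := IsFractionRing.injective 𝒪[k] k
  obtain ⟨u, hu⟩ := hd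
  have hd : ∀ l : List k, (∀ a ∈ l, a ≠ 0) → IsDiagonal q l (⊤ : Submodule k V) →
      ∃ (u : 𝒪[k]ˣ) (c : k), c ≠ 0 ∧ l.prod = algebraMap 𝒪[k] k u * c ^ 2 :=
    fun l hl h => HasDeterminant.exists_prod_eq h2k hq hu hl h
  -- the two cases of the existence part, as diagonalizations of lattices
  have hexists : ∀ (s : ℤˣ) (ϖ : 𝒪[k]), Irreducible ϖ → HasHasseWittInvariant q s →
      (s = 1 → ∃ us : List 𝒪[k]ˣ, IsDiagonal q (scaledUnits 1 us) (⊤ : Submodule k V)) ∧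
      (s = -1 → ∃ (us : List 𝒪[k]ˣ) (δ : 𝒪[k]ˣ), unitsQuadraticChar 𝒪[k] δ = -1 ∧
        IsDiagonal q (scaledUnits 1 us ++ scaledUnits (algebraMap 𝒪[k] k ϖ) [1, -δ])
          (⊤ : Submodule k V)) := by
    rintro s ϖ hϖ ⟨e, he, rfl⟩
    have hl : ∀ a ∈ List.ofFn fun i => q (e i), a ≠ 0 :=
      List.forall_mem_ofFn_iff.2 fun i => he.apply_ne_zero hq i
    rw [prod_prod_Ioi_hilbertSymbol]
    exact exists_isDiagonal_of_hasseWitt hk hϖ hl he.isDiagonal_top (hd _ hl he.isDiagonal_top)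
  have hnorm : ∀ ϖ : 𝒪[k], Irreducible ϖ → HasHasseWittInvariant q (-1) →
      ∃ (us : List 𝒪[k]ˣ) (δ : 𝒪[k]ˣ) (L : Submodule 𝒪[k] V), unitsQuadraticChar 𝒪[k] δ = -1 ∧
        IsDiagonal q (scaledUnits 1 us ++ scaledUnits (algebraMap 𝒪[k] k ϖ) [1, -δ]) L ∧
        Submodule.span k (L : Set V) = ⊤ := by
    intro ϖ hϖ hhw
    obtain ⟨us, δ, hδ, h⟩ := (hexists _ ϖ hϖ hhw).2 rfl
    obtain ⟨L, hL, hspan⟩ := h.exists_span_eq 𝒪[k]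
    exact ⟨us, δ, L, hδ, hL, hspan⟩
  have hlist : ∀ ϖ : 𝒪[k], Irreducible ϖ → ∀ us vs : List 𝒪[k]ˣ,
      (∀ a ∈ scaledUnits 1 us ++ scaledUnits (algebraMap 𝒪[k] k ϖ) vs, a ≠ 0) ∧
      ∀ a ∈ scaledUnits 1 us ++ scaledUnits (algebraMap 𝒪[k] k ϖ) vs,
        a ∈ Set.range (algebraMap 𝒪[k] k) := by
    intro ϖ hϖ us vs
    refine ⟨fun a ha => ?_, fun a ha => ?_⟩
    · rcases List.mem_append.1 ha with ha | ha
      · exact scaledUnits_ne_zero one_ne_zero _ a ha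
      · refine scaledUnits_ne_zero ?_ _ a ha
        rw [map_ne_zero_iff _ hinj]
        exact hϖ.ne_zero
    · rcases List.mem_append.1 ha with ha | ha <;> obtain ⟨u, -, rfl⟩ := List.mem_map.1 ha
      · exact ⟨u, (one_mul _).symm⟩
      · exact ⟨ϖ * u, map_mul _ _ _⟩
  refine ⟨fun hhw => ⟨?_, fun L L' hL hL' => ?_⟩,
    fun hhw => ⟨?_, fun ϖ hϖ ℓ _ _ hℓ => ⟨?_, fun L L' hL hL' => ?_⟩⟩⟩
  · obtain ⟨ϖ, hϖ⟩ := IsDiscreteValuationRing.exists_irreducible 𝒪[k]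
    obtain ⟨us, h⟩ := (hexists _ ϖ hϖ hhw).1 rfl
    obtain ⟨L, hL, hspan⟩ := h.exists_span_eq 𝒪[k]
    have hdual : dual q L = L := hL.dualSubmodule_eq h2 hspan
    exact ⟨L, { isLattice := ⟨hL.fg, hspan⟩, le_dual := hdual.ge, dual_eq := hdual }⟩
  · have hs := hL.isLattice.span_eq_top
    have hs' := hL'.isLattice.span_eq_top
    obtain ⟨us, h⟩ := exists_isDiagonal_units_of_dualSubmodule_eq h2 hq hs hL.dual_eq
    obtain ⟨us', h'⟩ := exists_isDiagonal_units_of_dualSubmodule_eq h2 hq hs' hL'.dual_eq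
    have hl := scaledUnits_ne_zero (one_ne_zero (α := k)) us
    have hl' := scaledUnits_ne_zero (one_ne_zero (α := k)) us'
    have hlen : us.length = us'.length := by
      have h1 := (h.length_eq h2k hl hs).trans (h'.length_eq h2k hl' hs').symm
      simpa using h1
    obtain ⟨c, -, hc⟩ := h.exists_prod_eq_prod_mul_sq h2k hl hl' h' hs hs'
    rw [prod_scaledUnits, prod_scaledUnits, one_pow, one_pow, mul_one, mul_one] at hc
    exact (h.change_units hk 1 hlen (exists_unit_eq_mul_sq hc)).areConjugate h2k hl' h' hs hs'
  · rintro ⟨L, hL⟩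
    obtain ⟨ϖ, hϖ⟩ := IsDiscreteValuationRing.exists_irreducible 𝒪[k]
    obtain ⟨us, δ, M, hδ, hM, hspan⟩ := hnorm ϖ hϖ hhw
    obtain ⟨haniso, hne⟩ := hM.anisotropic hk hϖ hδ hspan
    have := hL.isLattice
    have : Submodule.IsLattice k M := ⟨hM.fg, hspan⟩
    exact dualSubmodule_ne_of_anisotropic h2 hq (hM.le_dualSubmodule h2 (hlist ϖ hϖ us _).1
      (hlist ϖ hϖ us _).2 hspan) hne haniso L hL.dual_eq
  · obtain ⟨us, δ, M, hδ, hM, hspan⟩ := hnorm ϖ hϖ hhw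
    exact ⟨M, { isLattice := ⟨hM.fg, hspan⟩
                le_dual := hM.le_dualSubmodule h2 (hlist ϖ hϖ us _).1 (hlist ϖ hϖ us _).2 hspan
                isometric := hM.exists_norm_isometry hk hϖ hδ hspan ℓ hℓ }⟩
  · have hs := hL.isLattice.span_eq_top
    have hs' := hL'.isLattice.span_eq_top
    obtain ⟨us, δ, hδ, h⟩ := exists_isDiagonal_of_anisotropic hk hq hd hϖ hs hL.le_dual
      (hL.smul_mem hϖ) (hL.mem_of_apply_mem_range hϖ hℓ) hL.dual_ne
    obtain ⟨us', δ', hδ', h'⟩ := exists_isDiagonal_of_anisotropic hk hq hd hϖ hs' hL'.le_dual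
      (hL'.smul_mem hϖ) (hL'.mem_of_apply_mem_range hϖ hℓ) hL'.dual_ne
    have hl := (hlist ϖ hϖ us [1, -δ]).1
    have hl' := (hlist ϖ hϖ us' [1, -δ']).1
    have hlen : us.length = us'.length := by
      have h1 := (h.length_eq h2k hl hs).trans (h'.length_eq h2k hl' hs').symm
      simpa using h1
    -- `δ` and `δ'` are both non-squares, so that the unimodular parts have the same determinant
    obtain ⟨x, rfl⟩ := exists_eq_mul_sq_of_unitsQuadraticChar_eq hk (hδ.trans hδ'.symm)
    obtain ⟨c, -, hc⟩ := h.exists_prod_eq_prod_mul_sq h2k hl hl' h' hs hs'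
    have hϖ0 : algebraMap 𝒪[k] k ϖ ≠ 0 := by
      rw [map_ne_zero_iff _ hinj]
      exact hϖ.ne_zero
    obtain ⟨w, hw⟩ : ∃ w : 𝒪[k]ˣ, us.prod = us'.prod * w ^ 2 := by
      have hx : algebraMap 𝒪[k] k x ≠ 0 := algebraMap_unit_ne_zero x
      have hδ0 : algebraMap 𝒪[k] k δ' ≠ 0 := algebraMap_unit_ne_zero δ'
      refine exists_unit_eq_mul_sq (k := k) (c := c / algebraMap 𝒪[k] k x) ?_
      simp only [List.prod_append, prod_scaledUnits, one_pow, mul_one, List.prod_cons,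
        List.prod_nil, List.length_cons, List.length_nil, one_mul, Units.val_neg, Units.val_mul,
        Units.val_pow_eq_pow_val, map_neg, map_mul, map_pow] at hc
      have h0 : algebraMap 𝒪[k] k δ' * algebraMap 𝒪[k] k ϖ ^ 2 ≠ 0 :=
        mul_ne_zero hδ0 (pow_ne_zero 2 hϖ0)
      apply mul_left_cancel₀ h0
      field_simp
      field_simp at hc
      linear_combination -hc
    refine IsDiagonal.areConjugate h2k hl' ?_ h' hs hs'
    obtain ⟨L₁, L₂, h₁, h₂, h₁₂, rfl⟩ := isDiagonal_append.1 h
    exact isDiagonal_append.2 ⟨L₁, L₂, h₁.change_units hk 1 hlen ⟨w, hw⟩,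
      h₂.change_units (us := [1, -(δ' * x ^ 2)]) (us' := [1, -δ']) hk _ rfl
        ⟨x, by simp only [List.prod_cons, List.prod_nil, mul_one, one_mul, neg_mul]⟩, h₁₂, rfl⟩
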